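/- \textbf{Setting.} Let $D\subseteq\mathbb{R}^d$ be a non-empty Borel set whose affine hull is $\mathbb{R}^d$, and let $\widehat D=D\cup\{\delta\}$ carry the Alexandrov topology and the $\sigma$-algebra generated by the Borel sets of $D$ and $\{\delta\}$. Let $X=(X_t)_{t\ge 0}$ be a càdlàg $\widehat D$-valued time-homogeneous Markov process, adapted to a right-continuous filtration, under probability measures $(\mathbb{P}^x)_{x\in\widehat D}$, whose transition kernel $p_t(x,A)=\mathbb{P}^x(X_t\in A)$ is measurable in $x$, normal ($p_0(x,\{x\})=1$), satisfies the Chapman–Kolmogorov equations, and has $\delta$ as an absorbing state. For $x\in\mathbb{R}^d$, $u\in\mathbb{C}^d$ write $\langle x,u\rangle=\sum_i x_iu_i$ (bilinear), and put $$\mathcal U=\{u\in\mathbb{C}^d:\ \sup_{x\in D}\operatorname{Re}\langle u,x\rangle<\infty\},\qquad \mathcal U_k=\{u\in\mathbb{C}^d:\ \sup_{x\in D}\operatorname{Re}\langle u,x\rangle\le k\}\quad(k\in\mathbb{N}).$$ The process $X$ is \emph{affine} if $p_s(x,\cdot)\to p_t(x,\cdot)$ weakly as $s\to t$ for all $t\ge0$,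 $x\in D$ (tested with bounded continuous functions on $D$, extended by $f(\delta)=0$), and there are functions $\Phi:\mathbb{R}_{\ge0}\times\mathcal U\to\mathbb{C}$, $\psi:\mathbb{R}_{\ge0}\times\mathcal U\to\mathbb{C}^d$ with $$\int_D e^{\langle \xi,u\rangle}\,p_t(x,d\xi)=\Phi(t,u)\,e^{\langle x,\psi(t,u)\rangle}\qquad(t\ge0,\ x\in D,\ u\in\mathcal U).$$ Let $\sigma(u)=\inf\{t\ge0:\Phi(t,u)=0\}\in[0,\infty]$ and $\mathcal Q_k=\{(t,u)\in\mathbb{R}_{\ge0}\times\mathcal U_k: t<\sigma(u)\}$. Here $\Phi$ and $\psi$ are chosen, together with a function $\phi$, such that $\Phi=e^{\phi}$ on $\bigcup_k\mathcal Q_k$, $\phi$ and $\psi$ are jointly continuous on each $\mathcal Q_k$, and $\phi(0,0)=0$, $\psi(0,0)=0$. The affine process is \emph{regular} if the derivatives $F(u)=\partial_t\phi(t,u)|_{t=0+}$ and $R(u)=\partial_t\psi(t,u)|_{t=0+}$ exist for all $u\in\mathcal U$ and are continuous on each $\mathcal U_k$. \textbf{Proposition.} Let $X$ be a regular affine process.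 Then there exist $b,\beta^1,\dots,\beta^d\in\mathbb{R}^d$, real $d\times d$ matrices $a,\alpha^1,\dots,\alpha^d$, real numbers $c,\gamma^1,\dots,\gamma^d$ and signed Borel measures $m,\mu^1,\dots,\mu^d$ on $\mathbb{R}^d\setminus\{0\}$ (each a difference of two positive measures that integrate $\|\xi\|^2\wedge1$) such that for all $u\in\mathcal U$ and $i=1,\dots,d$, with absolutely convergent integrals and $h(\xi)=\xi\mathbf 1_{\{\|\xi\|\le1\}}$, $$F(u)=\tfrac12\langle u,au\rangle+\langle b,u\rangle-c+\int_{\mathbb{R}^d\setminus\{0\}}\bigl(e^{\langle\xi,u\rangle}-1-\langle h(\xi),u\rangle\bigr)\,m(d\xi),$$ $$R_i(u)=\tfrac12\langle u,\alpha^iu\rangle+\langle\beta^i,u\rangle-\gamma^i+\int_{\mathbb{R}^d\setminus\{0\}}\bigl(e^{\langle\xi,u\rangle}-1-\langle h(\xi),u\rangle\bigr)\,\mu^i(d\xi),$$ and such that for every $x\in D$: the matrix $A(x)=a+\sum_ix_i\alpha^i$ is symmetric positive semidefinite; $C(x)=c+\sum_ix_i\gamma^i\ge0$; and $\nu(x,d\xi)=m(d\xi)+\sum_ix_i\mu^i(d\xi)$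 is a positive measure with $\int_{\mathbb{R}^d\setminus\{0\}}(\|\xi\|^2\wedge1)\,\nu(x,d\xi)<\infty$. Moreover, for every $u\in\mathcal U$ we have $\phi(0,u)=0$, $\psi(0,u)=u$, and for all $t\in[0,\sigma(u))$ we have $\psi(t,u)\in\mathcal U$ and $$\partial_t\phi(t,u)=F(\psi(t,u)),\qquad \partial_t\psi(t,u)=R(\psi(t,u)),$$ where the derivatives at $t=0$ are right derivatives. -/

import Mathlib

open MeasureTheory Filter Topology Set
open scoped NNReal ENNReal BoundedContinuousFunction

noncomputable section

namespace AffineProc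

/-- The real Euclidean space `ℝ^d`. -/
abbrev E (d : ℕ) : Type := EuclideanSpace ℝ (Fin d)

/-- The complex space `ℂ^d`. -/
abbrev V (d : ℕ) : Type := EuclideanSpace ℂ (Fin d)

/-- The bilinear (not sesquilinear) pairing `⟨ξ, u⟩ = ∑ i, ξ_i u_i` of `ξ ∈ ℝ^d`, `u ∈ ℂ^d`. -/
def pairing {d : ℕ} (ξ : E d) (u : V d) : ℂ := ∑ i, (ξ i : ℂ) * u i

/-- The bilinear form `⟨u, a u⟩ = ∑ i j, u_i a_ij u_j` of a real matrix `a` at `u ∈ ℂ^d`. -/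
def quadForm {d : ℕ} (a : Matrix (Fin d) (Fin d) ℝ) (u : V d) : ℂ :=
  ∑ i, ∑ j, u i * (a i j : ℂ) * u j

/-! ### The state space with a cemetery state

For `D ⊆ ℝ^d`, the space `D ∪ {δ}` is `OnePoint D`: the point `δ` is `∞`, and the topology that
Mathlib puts on it is the Alexandrov topology. -/

/-- The σ-algebra generated by the measurable subsets of `α` and by `{δ}`: a set belongs to it
iff its trace on `α` is measurable. -/
instance cemeterySigmaAlgebra (α : Type*) [MeasurableSpace α] : MeasurableSpace (OnePoint α) :=
  MeasurableSpace.map ((↑) : α → OnePoint α) inferInstance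

/-- A function on `D`, extended to `D ∪ {δ}` by `f(δ) = 0`. Thus `∫ y, extendZero f y ∂p` is the
integral `∫_D f dp`. -/
def extendZero {α G : Type*} [Zero G] (f : α → G) (y : OnePoint α) : G := y.elim 0 f

/-- A càdlàg time-homogeneous Markov process with state space `D ∪ {δ}`, with absorbing cemetery
state `δ`, on the filtered space `(Ω, ℱ)` with the laws `(ℙ^x)`, `x ∈ D ∪ {δ}`. Its transition
kernel is `p_t(x, A) = ℙ^x (X_t ∈ A)`, written `(P x).map (X t) A`. -/
structure MarkovProcess {d : ℕ} (D : Set (E d)) (Ω : Type*) [mΩ : MeasurableSpace Ω] where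
  /-- the laws `ℙ^x` -/
  P : OnePoint D → Measure Ω
  isProbabilityMeasure : ∀ x, IsProbabilityMeasure (P x)
  /-- the filtration -/
  ℱ : Filtration ℝ≥0 mΩ
  rightContinuous : ℱ.IsRightContinuous
  /-- the process -/
  X : ℝ≥0 → Ω → OnePoint D
  adapted : ∀ t, Measurable[ℱ t] (X t)
  path_rightContinuous : ∀ ω t, ContinuousWithinAt (fun s => X s ω) (Ici t) t
  path_leftLimits : ∀ ω t, 0 < t → ∃ l, Tendsto (fun s => X s ω) (𝓝[<] t) (𝓝 l)
  /-- `x ↦ p_t(x, A)` is measurable -/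
  kernel_measurable : ∀ t A, MeasurableSet A → Measurable fun x => (P x).map (X t) A
  /-- `p_0(x, {x}) = 1` -/
  kernel_normal : ∀ x, (P x).map (X 0) {x} = 1
  /-- `p_t(δ, {δ}) = 1` -/
  kernel_absorbing : ∀ t, (P OnePoint.infty).map (X t) {OnePoint.infty} = 1
  /-- `p_t(x, D ∪ {δ}) = 1` -/
  kernel_univ : ∀ t x, (P x).map (X t) univ = 1
  /-- the Chapman–Kolmogorov equation -/
  chapman_kolmogorov : ∀ t s x A, MeasurableSet A →
    (P x).map (X (t + s)) A = ∫⁻ y, (P y).map (X t) A ∂((P x).map (X s))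
  /-- the Markov property `ℙ^x (X_{s+t} ∈ A | ℱ_s) = p_t(X_s, A)` -/
  markov : ∀ x s t B A, MeasurableSet[ℱ s] B → MeasurableSet A →
    P x (B ∩ X (s + t) ⁻¹' A) = ∫⁻ ω in B, (P (X s ω)).map (X t) A ∂(P x)

/-- The transition kernel `p_t(x, ·)`, a probability measure on `D ∪ {δ}`. -/
def MarkovProcess.kernel {d : ℕ} {D : Set (E d)} {Ω : Type*} [MeasurableSpace Ω]
    (M : MarkovProcess D Ω) (t : ℝ≥0) (x : OnePoint D) : Measure (OnePoint D) :=
  (M.P x).map (M.X t)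

/-- `𝒰 = {u ∈ ℂ^d : sup_{x ∈ D} Re⟨u, x⟩ < ∞}`. -/
def U {d : ℕ} (D : Set (E d)) : Set (V d) :=
  {u | BddAbove ((fun x : E d => (pairing x u).re) '' D)}

/-- `𝒰_k = {u ∈ ℂ^d : sup_{x ∈ D} Re⟨u, x⟩ ≤ k}`. -/
def Uk {d : ℕ} (D : Set (E d)) (k : ℕ) : Set (V d) :=
  {u | ∀ x ∈ D, (pairing x u).re ≤ k}

/-- `M` is affine with state space `D`, and `Φ`, `ψ` represent its Fourier–Laplace transform.
Functions on `ℝ≥0 × 𝒰` are represented by functions on `ℝ × ℂ^d`, of which only the values on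
`ℝ≥0 × 𝒰` are ever used. -/
structure IsAffine {d : ℕ} {D : Set (E d)} {Ω : Type*} [MeasurableSpace Ω]
    (M : MarkovProcess D Ω) (Φ : ℝ → V d → ℂ) (ψ : ℝ → V d → V d) : Prop where
  /-- `p_s(x, ·) → p_t(x, ·)` weakly as `s → t`; test functions are extended by `f(δ) = 0` -/
  stochContinuous : ∀ (t : ℝ≥0) (x : D) (f : D →ᵇ ℝ),
    Tendsto (fun s => ∫ y, extendZero f y ∂(M.kernel s x)) (𝓝 t)
      (𝓝 (∫ y, extendZero f y ∂(M.kernel t x)))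
  /-- `∫_D e^{⟨ξ, u⟩} p_t(x, dξ) = Φ(t, u) exp⟨x, ψ(t, u)⟩` -/
  affine : ∀ (t : ℝ≥0) (x : D), ∀ u ∈ U D,
    ∫ y, extendZero (fun ξ : D => Complex.exp (pairing ξ u)) y ∂(M.kernel t x)
      = Φ t u * Complex.exp (pairing x (ψ t u))

/-- `σ(u) = inf {t ≥ 0 : Φ(t, u) = 0}`, which is `∞` if `Φ(·, u)` has no zero. -/
def sigma {d : ℕ} (Φ : ℝ → V d → ℂ) (u : V d) : ℝ≥0∞ :=
  ⨅ (t : ℝ≥0) (_ : Φ t u = 0), (t : ℝ≥0∞)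

/-- `𝒬_k = {(t, u) ∈ ℝ≥0 × 𝒰_k : t < σ(u)}`. -/
def Qk {d : ℕ} (D : Set (E d)) (Φ : ℝ → V d → ℂ) (k : ℕ) : Set (ℝ × V d) :=
  {q | 0 ≤ q.1 ∧ q.2 ∈ Uk D k ∧ ENNReal.ofReal q.1 < sigma Φ q.2}

/-- `φ` and `ψ` are the distinguished exponents: `Φ = e^φ` on `𝒬 = ⋃ k, 𝒬_k`, both are jointly
continuous on every `𝒬_k`, and `φ(0, 0) = ψ(0, 0) = 0`. -/
structure IsDistinguished {d : ℕ} (D : Set (E d)) (Φ : ℝ → V d → ℂ)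
    (φ : ℝ → V d → ℂ) (ψ : ℝ → V d → V d) : Prop where
  exp_phi : ∀ k, ∀ q ∈ Qk D Φ k, Φ q.1 q.2 = Complex.exp (φ q.1 q.2)
  continuousOn_phi : ∀ k, ContinuousOn (fun q : ℝ × V d => φ q.1 q.2) (Qk D Φ k)
  continuousOn_psi : ∀ k, ContinuousOn (fun q : ℝ × V d => ψ q.1 q.2) (Qk D Φ k)
  phi_zero : φ 0 0 = 0
  psi_zero : ψ 0 0 = 0

/-- Regularity: the right derivatives `F(u) = ∂_t φ(t, u)|_{t=0+}` and
`R(u) = ∂_t ψ(t, u)|_{t=0+}` exist for `u ∈ 𝒰` and are continuous on every `𝒰_k`. -/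
structure IsRegular {d : ℕ} (D : Set (E d)) (φ : ℝ → V d → ℂ) (ψ : ℝ → V d → V d)
    (F : V d → ℂ) (R : V d → V d) : Prop where
  deriv_phi : ∀ u ∈ U D, HasDerivWithinAt (fun t => φ t u) (F u) (Ici 0) 0
  deriv_psi : ∀ u ∈ U D, HasDerivWithinAt (fun t => ψ t u) (R u) (Ici 0) 0
  continuousOn_F : ∀ k, ContinuousOn F (Uk D k)
  continuousOn_R : ∀ k, ContinuousOn R (Uk D k)

/-! ### Lévy–Khintchine form -/

/-- `ν` is a Lévy measure on `ℝ^d \ {0}`, seen as a measure on `ℝ^d` that does not charge `0`: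
`∫ (‖ξ‖² ∧ 1) ν(dξ) < ∞`. -/
def IsLevyMeasure {d : ℕ} (ν : Measure (E d)) : Prop :=
  ν {0} = 0 ∧ ∫⁻ ξ, ENNReal.ofReal (min (‖ξ‖ ^ 2) 1) ∂ν < ∞

/-- A signed Borel measure on `ℝ^d \ {0}`, possibly with infinite positive and negative mass near
`0`: the difference `pos - neg` of two Lévy measures. -/
structure SignedLevyMeasure (d : ℕ) where
  pos : Measure (E d)
  neg : Measure (E d)
  isLevy_pos : IsLevyMeasure pos
  isLevy_neg : IsLevyMeasure neg

/-- The value `m(A) = pos(A) - neg(A)`, meaningful for Borel sets `A` that are bounded away from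
`0`, on which `pos` and `neg` are finite. -/
def SignedLevyMeasure.value {d : ℕ} (m : SignedLevyMeasure d) (A : Set (E d)) : ℝ :=
  (m.pos A).toReal - (m.neg A).toReal

/-- Integrability with respect to a signed measure. -/
def SignedLevyMeasure.Integrable {d : ℕ} (m : SignedLevyMeasure d) (g : E d → ℂ) : Prop :=
  MeasureTheory.Integrable g m.pos ∧ MeasureTheory.Integrable g m.neg

/-- The integral with respect to a signed measure. -/
def SignedLevyMeasure.integral {d : ℕ} (m : SignedLevyMeasure d) (g : E d → ℂ) : ℂ :=
  ∫ ξ, g ξ ∂m.pos - ∫ ξ, g ξ ∂m.neg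

/-- The truncation function `h(ξ) = ξ 1_{‖ξ‖ ≤ 1}`. -/
def trunc {d : ℕ} (ξ : E d) : E d := if ‖ξ‖ ≤ 1 then ξ else 0

/-- The integrand `e^{⟨ξ, u⟩} - 1 - ⟨h(ξ), u⟩`. -/
def lkIntegrand {d : ℕ} (u : V d) (ξ : E d) : ℂ :=
  Complex.exp (pairing ξ u) - 1 - pairing (trunc ξ) u

/-- `g` equals `½⟨u, a u⟩ + ⟨b, u⟩ - c + ∫ (e^{⟨ξ, u⟩} - 1 - ⟨h(ξ), u⟩) m(dξ)` for all `u ∈ S`,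
where the integral converges absolutely. -/
def HasLKForm {d : ℕ} (S : Set (V d)) (g : V d → ℂ) (a : Matrix (Fin d) (Fin d) ℝ) (b : E d)
    (c : ℝ) (m : SignedLevyMeasure d) : Prop :=
  ∀ u ∈ S, m.Integrable (lkIntegrand u) ∧
    g u = 1 / 2 * quadForm a u + pairing b u - c + m.integral (lkIntegrand u)

/-- The positive measure `ν` is the signed measure `m + x_1 μ^1 + ⋯ + x_d μ^d`; this is tested on
all Borel sets that are bounded away from `0`. -/
def IsAffineCombination {d : ℕ} (ν : Measure (E d)) (m : SignedLevyMeasure d)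
    (μ : Fin d → SignedLevyMeasure d) (x : E d) : Prop :=
  ∀ A : Set (E d), MeasurableSet A → (∃ ε > 0, ∀ ξ ∈ A, ε ≤ ‖ξ‖) →
    (ν A).toReal = m.value A + ∑ i, x i * (μ i).value A

end AffineProc

end

/-!
The proof has two independent halves, both of which start from the transform
`∫ e^{⟨ξ, u⟩} p_t(x, dξ) = Φ(t, u) e^{⟨x, ψ(t, u)⟩}`.

*Riccati equations.* The normality of the transition kernel and the Chapman–Kolmogorov equation turn
into multiplicative identities for the transform. Taking continuous logarithms (`eq_zero_of_exp_eq_one`)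
and comparing affine functions of `x ∈ D` (`eq_zero_of_pairing_add`) gives the initial values
`φ(0, u) = 0`, `ψ(0, u) = u` (`initial_values`) and the semiflow property
`φ(t + s, u) = φ(t, u) + φ(s, ψ(t, u))`, `ψ(t + s, u) = ψ(s, ψ(t, u))` (`semiflow`). Hence the right
derivatives at time `t` are `F(ψ(t, u))` and `R(ψ(t, u))`. They are continuous in `t`, because
`ψ(·, u)` stays in one set `𝒰_k` on compact time intervals, so they are derivatives (`riccati`).

*Lévy–Khintchine form.* For fixed `x ∈ D` the function `η(u) = F(u) + ⟨x, R(u)⟩` is the limit, as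
`t ↓ 0`, of `t⁻¹ (E^x[e^{⟨X_t - x, u⟩}; X_t ≠ δ] - 1)`, which is an exponent
`∫ (e^{⟨ξ, u⟩} - 1) ν_t(dξ) - c_t` with a finite measure `ν_t`. Such limits have Lévy–Khintchine form
as soon as `η` is continuous on `i ℝ^d` (`exists_levyKhintchine`). With the Gaussian weight
`w(ξ) = 1 - e^{-‖ξ‖²/2}`, the characteristic function of `w ν_t` is a Gaussian mean of second
differences of that of `ν_t` (`charFun_weighted`). These converge pointwise, and they are dominated
by Baire's theorem (`exists_quadratic_bound`), so the measures `w ν_t` are tight and converge weakly.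
The integrands are compensated to second order with `sin ξ_j` in place of `ξ_j`: then they are `w`
times a bounded continuous function, and the compensating terms `∫ sin ξ_j dν_t`,
`∫ sin ξ_j sin ξ_k dν_t` are themselves combinations of values of the exponents, so they converge. For
`u ∈ 𝒰` with a real part this works because `ν_t` lives on a half-space on which `Re⟨ξ, u⟩` is
bounded.

Since `D` spans `ℝ^d` affinely, `F` and `R_i` are real linear combinations of the exponents `η` for
various `x ∈ D`, so they have Lévy–Khintchine form with signed measures (`mem_lkSubmodule`). The
positivity statements for a given `x ∈ D` follow because the triplet is determined by the exponent:
`-½⟨y, A(x) y⟩` is the limit of `η(i n y) / n²`, with non-positive real part; `C(x) = -η(0)`; and the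
second differences of `η` are the characteristic functions of `(1 - cos⟨ξ, z⟩) ν(x, dξ)`, up to a
constant, which identifies the signed combination `m + ∑ x_i μ^i` with the Lévy measure of `η`
(`HasLKForm.pos_add_neg_eq`).
-/

noncomputable section

namespace AffineProc

/-! ### The bilinear pairing and the sets `𝒰`, `𝒰_k` -/

section FourierLaplace

variable {d : ℕ}

@[simp] lemma pairing_zero_left (u : V d) : pairing 0 u = 0 := by simp [pairing]

@[simp] lemma pairing_zero_right (x : E d) : pairing x 0 = 0 := by simp [pairing]

lemma pairing_add_left (x y : E d) (u : V d) : pairing (x + y) u = pairing x u + pairing y u := by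
  simp [pairing, add_mul, Finset.sum_add_distrib]

lemma pairing_sub_left (x y : E d) (u : V d) : pairing (x - y) u = pairing x u - pairing y u := by
  simp [pairing, sub_mul, Finset.sum_sub_distrib]

lemma pairing_smul_left (c : ℝ) (x : E d) (u : V d) : pairing (c • x) u = c * pairing x u := by
  simp [pairing, Finset.mul_sum, mul_assoc]

lemma pairing_sub_right (x : E d) (u v : V d) : pairing x (u - v) = pairing x u - pairing x v := by
  simp [pairing, mul_sub, Finset.sum_sub_distrib]

lemma pairing_smul_right (c : ℝ) (x : E d) (u : V d) : pairing x (c • u) = c * pairing x u := by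
  simp only [pairing, PiLp.smul_apply, Complex.real_smul, Finset.mul_sum]
  exact Finset.sum_congr rfl fun i _ => by ring

lemma pairing_single (i : Fin d) (u : V d) : pairing (EuclideanSpace.single i (1 : ℝ)) u = u i := by
  simp [pairing, apply_ite]

@[fun_prop]
lemma continuous_pairing_left (u : V d) : Continuous fun x : E d => pairing x u := by
  unfold pairing; fun_prop

@[fun_prop]
lemma continuous_pairing_right (x : E d) : Continuous fun u : V d => pairing x u := by
  unfold pairing; fun_prop

variable {D : Set (E d)}

lemma mem_U_iff {u : V d} : u ∈ U D ↔ ∃ k : ℕ, u ∈ Uk D k := by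
  constructor
  · rintro ⟨c, hc⟩
    obtain ⟨k, hk⟩ := exists_nat_ge c
    exact ⟨k, fun x hx => (hc (mem_image_of_mem _ hx)).trans hk⟩
  · rintro ⟨k, hk⟩
    exact ⟨k, by rintro _ ⟨x, hx, rfl⟩; exact hk x hx⟩

lemma zero_mem_Uk (k : ℕ) : (0 : V d) ∈ Uk D k := fun x _ => by simp

lemma isPreconnected_Uk (k : ℕ) : IsPreconnected (Uk D k) := by
  have h : StarConvex ℝ 0 (Uk D k) := ?_
  · exact (h.isPathConnected (zero_mem_Uk k)).isConnected.isPreconnected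
  intro u hu a b ha hb hab x hx
  have h := hu x hx
  rw [smul_zero, zero_add, pairing_smul_right, Complex.re_ofReal_mul]
  have hk : (0 : ℝ) ≤ k := Nat.cast_nonneg k
  nlinarith

/-- A submodule of `ℝ^d` that contains all the differences of points of `D` is `ℝ^d`. -/
lemma eq_top_of_sub_mem (hD : affineSpan ℝ D = ⊤) (W : Submodule ℝ (E d))
    (h : ∀ x ∈ D, ∀ y ∈ D, x - y ∈ W) : W = ⊤ := by
  rw [eq_top_iff, ← AffineSubspace.direction_top ℝ (E d) (E d), ← hD, direction_affineSpan,
    vectorSpan_def, Submodule.span_le]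
  rintro _ ⟨x, hx, y, hy, rfl⟩
  exact h x hx y hy

/-- An affine function `x ↦ c + ⟨x, v⟩` that vanishes on `D` is zero. -/
lemma eq_zero_of_pairing_add (hne : D.Nonempty) (hD : affineSpan ℝ D = ⊤) {c : ℂ} {v : V d}
    (h : ∀ x ∈ D, c + pairing x v = 0) : c = 0 ∧ v = 0 := by
  let W : Submodule ℝ (E d) :=
    { carrier := {w | pairing w v = 0}
      add_mem' := fun {a b} ha hb => by
        simp only [mem_ofPred_eq] at *
        rw [pairing_add_left, ha, hb, add_zero]
      zero_mem' := by simp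
      smul_mem' := fun r w hw => by
        simp only [mem_ofPred_eq] at *
        rw [pairing_smul_left, hw, mul_zero] }
  have hW : W = ⊤ := eq_top_of_sub_mem hD W fun x hx y hy => by
    change pairing (x - y) v = 0
    rw [pairing_sub_left]
    linear_combination h x hx - h y hy
  have hall : ∀ w, pairing w v = 0 := fun w => (hW ▸ Submodule.mem_top : w ∈ W)
  obtain ⟨x, hx⟩ := hne
  refine ⟨by simpa [hall x] using h x hx, ?_⟩
  ext i
  simpa [pairing_single] using hall (EuclideanSpace.single i 1)

/-- A continuous logarithm of the constant `1` on a connected set that vanishes at one point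
vanishes identically. -/
lemma eq_zero_of_exp_eq_one {T : Type*} [TopologicalSpace T] {S : Set T} (hS : IsPreconnected S)
    {g : T → ℂ} (hg : ContinuousOn g S) (h : ∀ s ∈ S, Complex.exp (g s) = 1) {s₀ : T}
    (hs₀ : s₀ ∈ S) (h₀ : g s₀ = 0) {s : T} (hs : s ∈ S) : g s = 0 := by
  obtain ⟨n, hn⟩ := Complex.exp_eq_one_iff.1 (h s hs)
  have hpre : IsPreconnected ((fun t => (g t).im) '' S) :=
    hS.image _ (Complex.continuous_im.comp_continuousOn hg)
  have hpi := Real.pi_pos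
  suffices hn0 : n = 0 by simp [hn, hn0]
  by_contra hne
  -- the value `± π` would be attained on the way from `0` to `2 π n`
  have him : (g s).im = n * (2 * Real.pi) := by
    rw [hn]; simp
  have hmem0 : (0 : ℝ) ∈ (fun t => (g t).im) '' S := ⟨s₀, hs₀, by simp [h₀]⟩
  have hmem : n * (2 * Real.pi) ∈ (fun t => (g t).im) '' S := ⟨s, hs, him⟩
  obtain ⟨t, ht, htm⟩ : ∃ t ∈ S, (g t).im = Real.pi ∨ (g t).im = -Real.pi := by
    rcases lt_or_gt_of_ne hne with hneg | hpos
    · have h1 : (n : ℝ) ≤ -1 := by exact_mod_cast Int.le_sub_one_of_lt hneg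
      obtain ⟨t, ht, htt⟩ := hpre.ordConnected.out hmem hmem0
        (show -Real.pi ∈ Icc _ _ from ⟨by nlinarith, by linarith⟩)
      exact ⟨t, ht, Or.inr htt⟩
    · have h1 : (1 : ℝ) ≤ n := by exact_mod_cast hpos
      obtain ⟨t, ht, htt⟩ := hpre.ordConnected.out hmem0 hmem
        (show Real.pi ∈ Icc _ _ from ⟨hpi.le, by nlinarith⟩)
      exact ⟨t, ht, Or.inl htt⟩
  obtain ⟨m, hm⟩ := Complex.exp_eq_one_iff.1 (h t ht)
  have hm' : (g t).im = m * (2 * Real.pi) := by rw [hm]; simp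
  rcases htm with h1 | h1
  · have h2 : (2 * m : ℝ) = 1 := by
      have := hm'.symm.trans h1
      have h3 : Real.pi * (2 * m - 1) = 0 := by linarith
      have := (mul_eq_zero.1 h3).resolve_left hpi.ne'
      linarith
    have : 2 * m = 1 := by exact_mod_cast h2
    omega
  · have h2 : (2 * m : ℝ) = -1 := by
      have := hm'.symm.trans h1
      have h3 : Real.pi * (2 * m + 1) = 0 := by linarith
      have := (mul_eq_zero.1 h3).resolve_left hpi.ne'
      linarith
    have : 2 * m = -1 := by exact_mod_cast h2
    omega

/-! ### The Fourier–Laplace transform of the transition kernel -/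

lemma measurable_extendZero {α G : Type*} [MeasurableSpace α] [MeasurableSpace G] [Zero G]
    {f : α → G} (hf : Measurable f) : Measurable (extendZero f) := by
  intro s hs
  exact hf hs

lemma measurableSet_onePoint {α : Type*} [MeasurableSpace α] {s : Set (OnePoint α)} :
    MeasurableSet s ↔ MeasurableSet ((↑) ⁻¹' s : Set α) := Iff.rfl

@[simp] lemma extendZero_coe {α G : Type*} [Zero G] (f : α → G) (x : α) :
    extendZero f (x : OnePoint α) = f x := rfl

@[simp] lemma extendZero_infty {α G : Type*} [Zero G] (f : α → G) :
    extendZero f OnePoint.infty = 0 := rfl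

/-- The exponential `ξ ↦ e^{⟨ξ, u⟩}` on `D`. -/
def expD (D : Set (E d)) (u : V d) (ξ : D) : ℂ := Complex.exp (pairing ξ u)

lemma continuous_expD (u : V d) : Continuous (expD D u) := by
  unfold expD
  have := continuous_pairing_left u
  fun_prop

lemma norm_expD_le {k : ℕ} {u : V d} (hu : u ∈ Uk D k) (ξ : D) : ‖expD D u ξ‖ ≤ Real.exp k := by
  rw [expD, Complex.norm_exp]
  have := hu ξ ξ.2
  gcongr

lemma norm_extendZero_expD_le {k : ℕ} {u : V d} (hu : u ∈ Uk D k) (y : OnePoint D) :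
    ‖extendZero (expD D u) y‖ ≤ Real.exp k := by
  induction y using OnePoint.rec with
  | infty => simpa using Real.exp_nonneg _
  | coe ξ => exact norm_expD_le hu ξ

lemma measurable_extendZero_expD (u : V d) : Measurable (extendZero (expD D u)) :=
  measurable_extendZero (continuous_expD u).measurable

variable {Ω : Type*} [MeasurableSpace Ω] (M : MarkovProcess D Ω)

instance isProbabilityMeasure_kernel (t : ℝ≥0) (x : OnePoint D) :
    IsProbabilityMeasure (M.kernel t x) := ⟨M.kernel_univ t x⟩

lemma integrable_extendZero_expD {u : V d} (hu : u ∈ U D) (t : ℝ≥0) (x : OnePoint D) :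
    Integrable (extendZero (expD D u)) (M.kernel t x) := by
  obtain ⟨k, hk⟩ := mem_U_iff.1 hu
  exact Integrable.of_bound (measurable_extendZero_expD u).aestronglyMeasurable _
    (ae_of_all _ (norm_extendZero_expD_le hk))

lemma measurableSet_singleton_onePoint (x : OnePoint D) : MeasurableSet {x} := by
  rw [measurableSet_onePoint]
  exact (subsingleton_singleton.preimage OnePoint.coe_injective).measurableSet

lemma integral_of_measure_singleton (μ : Measure (OnePoint D)) [IsProbabilityMeasure μ]
    {x : OnePoint D} (h : μ {x} = 1) (f : OnePoint D → ℂ) : ∫ y, f y ∂μ = f x := by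
  have h0 : ∀ᵐ y ∂μ, f y = f x := by
    have := (prob_compl_eq_zero_iff (measurableSet_singleton_onePoint x)).2 h
    filter_upwards [mem_ae_iff.2 this] with y hy
    rw [mem_singleton_iff.1 hy]
  rw [integral_congr_ae h0]
  simp

/-- The transition kernel as a Markov kernel. -/
def transition (t : ℝ≥0) : ProbabilityTheory.Kernel (OnePoint D) (OnePoint D) where
  toFun := M.kernel t
  measurable' := Measure.measurable_of_measurable_coe _ fun A hA => M.kernel_measurable t A hA

lemma transition_comp (t s : ℝ≥0) (x : OnePoint D) :
    ((transition M t).comp (transition M s)) x = M.kernel (t + s) x := by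
  ext A hA
  rw [ProbabilityTheory.Kernel.comp_apply' _ _ _ hA]
  exact (M.chapman_kolmogorov t s x A hA).symm

lemma integral_kernel_add {u : V d} (hu : u ∈ U D) (t s : ℝ≥0) (x : OnePoint D) :
    ∫ y, extendZero (expD D u) y ∂(M.kernel (t + s) x)
      = ∫ y, (∫ z, extendZero (expD D u) z ∂(M.kernel t y)) ∂(M.kernel s x) := by
  have h := integrable_extendZero_expD M hu (t + s) x
  rw [← transition_comp] at h ⊢
  exact ProbabilityTheory.Kernel.integral_comp h

variable {M} {Φ φ : ℝ → V d → ℂ} {ψ : ℝ → V d → V d}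

namespace IsAffine

variable (haff : IsAffine M Φ ψ)

include haff

lemma integral_eq (t : ℝ≥0) (x : D) {u : V d} (hu : u ∈ U D) :
    ∫ y, extendZero (expD D u) y ∂(M.kernel t x) = Φ t u * Complex.exp (pairing x (ψ t u)) :=
  haff.affine t x u hu

lemma at_zero (x : D) {u : V d} (hu : u ∈ U D) :
    Φ 0 u * Complex.exp (pairing x (ψ 0 u)) = Complex.exp (pairing x u) := by
  have h := haff.integral_eq 0 x hu
  rw [integral_of_measure_singleton (M.kernel 0 x) (M.kernel_normal x)] at h
  simpa [expD] using h.symm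

lemma continuous_transform (x : D) {u : V d} (hu : u ∈ U D) :
    Continuous fun t : ℝ≥0 => Φ t u * Complex.exp (pairing x (ψ t u)) := by
  obtain ⟨k, hk⟩ := mem_U_iff.1 hu
  have hbd : ∀ (g : ℂ → ℝ), Continuous g → (∀ z, ‖g z‖ ≤ ‖z‖) → g 0 = 0 →
      Continuous fun t : ℝ≥0 => ∫ y, g (extendZero (expD D u) y) ∂(M.kernel t x) := by
    intro g hg hgb hg0
    let f : D →ᵇ ℝ := BoundedContinuousFunction.ofNormedAddCommGroup (fun ξ => g (expD D u ξ))
      (hg.comp (continuous_expD u)) (Real.exp k) fun ξ => (hgb _).trans (norm_expD_le hk ξ)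
    have hf : ∀ y, extendZero f y = g (extendZero (expD D u) y) := fun y => by
      induction y using OnePoint.rec with
      | infty => simp [hg0]
      | coe ξ => rfl
    refine continuous_iff_continuousAt.2 fun t => ?_
    have h := haff.stochContinuous t x f
    simp only [hf] at h
    exact h
  have hre := hbd Complex.re Complex.continuous_re Complex.abs_re_le_norm rfl
  have him := hbd Complex.im Complex.continuous_im Complex.abs_im_le_norm rfl
  have key : ∀ t : ℝ≥0, Φ t u * Complex.exp (pairing x (ψ t u)) =
      ((∫ y, (extendZero (expD D u) y).re ∂(M.kernel t x) : ℝ) : ℂ)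
        + ((∫ y, (extendZero (expD D u) y).im ∂(M.kernel t x) : ℝ) : ℂ) * Complex.I := by
    intro t
    rw [← haff.integral_eq t x hu]
    exact (integral_re_add_im (integrable_extendZero_expD M hu t x)).symm
  simp_rw [key]
  fun_prop

lemma Phi_zero_ne_zero (hne : D.Nonempty) {u : V d} (hu : u ∈ U D) : Φ 0 u ≠ 0 := by
  obtain ⟨x, hx⟩ := hne
  intro h0
  have := haff.at_zero ⟨x, hx⟩ hu
  rw [h0, zero_mul] at this
  exact Complex.exp_ne_zero _ this.symm

/-- `t < σ(u)` iff `Φ(·, u)` has no zero on `[0, t]`: the infimum `σ(u)` is attained because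
`Φ(·, u)` vanishes on a closed set of times. -/
lemma lt_sigma_iff (hne : D.Nonempty) {u : V d} (hu : u ∈ U D) (t : ℝ≥0) :
    (t : ℝ≥0∞) < sigma Φ u ↔ ∀ s ≤ t, Φ s u ≠ 0 := by
  obtain ⟨x, hx⟩ := hne
  constructor
  · intro h s hs h0
    have : sigma Φ u ≤ s := iInf₂_le s h0
    exact (lt_of_lt_of_le h this).not_ge (by exact_mod_cast hs)
  · intro h
    have hev : ∀ᶠ s : ℝ≥0 in 𝓝 t, Φ s u ≠ 0 := by
      have := (haff.continuous_transform ⟨x, hx⟩ hu).continuousAt.eventually_ne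
        (mul_ne_zero (h t le_rfl) (Complex.exp_ne_zero _))
      exact this.mono fun s hs => left_ne_zero_of_mul hs
    obtain ⟨ε, hε, hball⟩ := Metric.eventually_nhds_iff.1 hev
    have hlt : (t : ℝ≥0∞) < ((t + ⟨ε, hε.le⟩ : ℝ≥0) : ℝ≥0∞) := by
      have : (0 : ℝ≥0) < ⟨ε, hε.le⟩ := hε
      exact_mod_cast lt_add_of_pos_right t this
    refine lt_of_lt_of_le hlt (le_iInf₂ fun s hs => ?_)
    by_contra! hs'
    have hs'' : s < t + ⟨ε, hε.le⟩ := by exact_mod_cast hs'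
    rcases le_total s t with hst | hst
    · exact h s hst hs
    · refine hball ?_ hs
      have h1 : (s : ℝ) < t + ε := by exact_mod_cast hs''
      have h2 : (t : ℝ) ≤ s := by exact_mod_cast hst
      rw [NNReal.dist_eq, abs_of_nonneg (by linarith)]
      linarith

lemma sigma_pos (hne : D.Nonempty) {u : V d} (hu : u ∈ U D) : 0 < sigma Φ u := by
  refine (haff.lt_sigma_iff hne hu 0).2 fun s hs => ?_
  rw [nonpos_iff_eq_zero.1 hs]
  exact haff.Phi_zero_ne_zero hne hu

omit [MeasurableSpace Ω] haff in
/-- There is still some room between `t` and `σ(u)`. -/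
lemma exists_gt_lt_sigma {t : ℝ} (ht0 : 0 ≤ t) {u : V d}
    (ht : ENNReal.ofReal t < sigma Φ u) : ∃ T, t < T ∧ ENNReal.ofReal T < sigma Φ u := by
  obtain ⟨T, hT, hT'⟩ := ENNReal.lt_iff_exists_nnreal_btwn.1 ht
  refine ⟨T, ?_, by simpa using hT'⟩
  rwa [ENNReal.ofReal, ENNReal.coe_lt_coe, Real.toNNReal_lt_iff_lt_coe ht0] at hT

/-- For `u ∈ 𝒰_k` the transform is bounded by `e^k`, because `|e^{⟨·, u⟩}|` is. -/
lemma re_pairing_psi_le {k : ℕ} {u : V d} (hu : u ∈ Uk D k) (t : ℝ≥0) (x : D) {z : ℂ}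
    (hz : Φ t u = Complex.exp z) : (pairing x (ψ t u)).re ≤ k - z.re := by
  have h := haff.integral_eq t x (mem_U_iff.2 ⟨k, hu⟩)
  have hle : ‖Φ t u * Complex.exp (pairing x (ψ t u))‖ ≤ Real.exp k := by
    rw [← h]
    refine (norm_integral_le_of_norm_le_const
      (ae_of_all _ (norm_extendZero_expD_le hu))).trans ?_
    simp
  rw [hz, ← Complex.exp_add, Complex.norm_exp, Real.exp_le_exp, Complex.add_re] at hle
  linarith

/-- The semigroup property of the transform, from the Chapman–Kolmogorov equation. -/
lemma transform_add (t s : ℝ≥0) (x : D) {u : V d} (hu : u ∈ U D) (hψ : ψ t u ∈ U D) :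
    Φ ((t + s : ℝ≥0) : ℝ) u * Complex.exp (pairing x (ψ ((t + s : ℝ≥0) : ℝ) u))
      = Φ t u * (Φ s (ψ t u) * Complex.exp (pairing x (ψ s (ψ t u)))) := by
  rw [← haff.integral_eq (t + s) x hu, integral_kernel_add M hu, ← haff.integral_eq s x hψ,
    ← integral_const_mul]
  refine integral_congr_ae (ae_of_all _ fun y => ?_)
  induction y using OnePoint.rec with
  | infty =>
    change ∫ z, extendZero (expD D u) z ∂(M.kernel t OnePoint.infty) = _
    rw [integral_of_measure_singleton (M.kernel t OnePoint.infty) (M.kernel_absorbing t)]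
    simp
  | coe ξ =>
    change ∫ z, extendZero (expD D u) z ∂(M.kernel t ξ) = _
    rw [haff.integral_eq t ξ hu]
    rfl

end IsAffine

/-! ### The semiflow property and the Riccati equations -/

section Semiflow

variable (hne : D.Nonempty) (hspan : affineSpan ℝ D = ⊤) (haff : IsAffine M Φ ψ)
  (hdist : IsDistinguished D Φ φ ψ)

include hdist in
lemma Phi_eq_exp {u : V d} (hu : u ∈ U D) {t : ℝ} (ht0 : 0 ≤ t)
    (ht : ENNReal.ofReal t < sigma Φ u) : Φ t u = Complex.exp (φ t u) := by
  obtain ⟨k, hk⟩ := mem_U_iff.1 hu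
  exact hdist.exp_phi k (t, u) ⟨ht0, hk, ht⟩

include hdist in
lemma continuousOn_phi_time {u : V d} (hu : u ∈ U D) {T : ℝ}
    (hT : ENNReal.ofReal T < sigma Φ u) : ContinuousOn (fun t => φ t u) (Icc 0 T) := by
  obtain ⟨k, hk⟩ := mem_U_iff.1 hu
  exact (hdist.continuousOn_phi k).comp (f := fun t => (t, u)) (by fun_prop)
    fun t ht => ⟨ht.1, hk, (ENNReal.ofReal_le_ofReal ht.2).trans_lt hT⟩

include hdist in
lemma continuousOn_psi_time {u : V d} (hu : u ∈ U D) {T : ℝ}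
    (hT : ENNReal.ofReal T < sigma Φ u) : ContinuousOn (fun t => ψ t u) (Icc 0 T) := by
  obtain ⟨k, hk⟩ := mem_U_iff.1 hu
  exact (hdist.continuousOn_psi k).comp (f := fun t => (t, u)) (by fun_prop)
    fun t ht => ⟨ht.1, hk, (ENNReal.ofReal_le_ofReal ht.2).trans_lt hT⟩

include hne hspan haff hdist in
/-- `φ(0, u) = 0` and `ψ(0, u) = u`: both sides are continuous logarithms on the connected set
`𝒰_k`. -/
lemma initial_values {u : V d} (hu : u ∈ U D) : φ 0 u = 0 ∧ ψ 0 u = u := by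
  obtain ⟨k, hk⟩ := mem_U_iff.1 hu
  have hQ : MapsTo (fun v : V d => ((0 : ℝ), v)) (Uk D k) (Qk D Φ k) := fun v hv =>
    ⟨le_rfl, hv, by simpa using haff.sigma_pos hne (mem_U_iff.2 ⟨k, hv⟩)⟩
  have key : ∀ x ∈ D, φ 0 u + pairing x (ψ 0 u - u) = 0 := by
    intro x hx
    refine eq_zero_of_exp_eq_one (isPreconnected_Uk (D := D) k)
      (g := fun v => φ 0 v + pairing x (ψ 0 v - v)) ?_ ?_ (zero_mem_Uk k) ?_ hk
    · have h1 := (hdist.continuousOn_phi k).comp (by fun_prop) hQ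
      have h2 := (hdist.continuousOn_psi k).comp (by fun_prop) hQ
      exact h1.add ((continuous_pairing_right x).comp_continuousOn (h2.sub continuousOn_id))
    · intro v hv
      have h := haff.at_zero ⟨x, hx⟩ (mem_U_iff.2 ⟨k, hv⟩)
      rw [hdist.exp_phi k _ (hQ hv), ← Complex.exp_add] at h
      rw [pairing_sub_right, ← add_sub_assoc, Complex.exp_sub, h, div_self (Complex.exp_ne_zero _)]
    · simp [hdist.phi_zero, hdist.psi_zero]
  obtain ⟨h1, h2⟩ := eq_zero_of_pairing_add hne hspan key
  exact ⟨h1, sub_eq_zero.1 h2⟩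

include haff hdist in
lemma psi_mem_U {u : V d} (hu : u ∈ U D) {t : ℝ} (ht0 : 0 ≤ t)
    (ht : ENNReal.ofReal t < sigma Φ u) : ψ t u ∈ U D := by
  obtain ⟨k, hk⟩ := mem_U_iff.1 hu
  refine ⟨k - (φ t u).re, ?_⟩
  rintro _ ⟨x, hx, rfl⟩
  exact haff.re_pairing_psi_le hk ⟨t, ht0⟩ ⟨x, hx⟩ (Phi_eq_exp hdist hu ht0 ht)

include hne haff hdist in
lemma lt_sigma_psi {u : V d} (hu : u ∈ U D) {t s : ℝ} (ht0 : 0 ≤ t) (hs0 : 0 ≤ s)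
    (hts : ENNReal.ofReal (t + s) < sigma Φ u) : ENNReal.ofReal s < sigma Φ (ψ t u) := by
  have ht : ENNReal.ofReal t < sigma Φ u :=
    (ENNReal.ofReal_le_ofReal (by linarith)).trans_lt hts
  have hψ := psi_mem_U haff hdist hu ht0 ht
  have h := haff.lt_sigma_iff hne hψ ⟨s, hs0⟩
  have hs : ENNReal.ofReal s = ENNReal.ofNNReal ⟨s, hs0⟩ := ENNReal.ofReal_eq_coe_nnreal hs0
  rw [hs, h]
  intro r hr h0
  obtain ⟨x, hx⟩ := hne
  have hadd := haff.transform_add ⟨t, ht0⟩ r ⟨x, hx⟩ hu hψ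
  change _ = Φ t u * (Φ r (ψ t u) * _) at hadd
  rw [h0, zero_mul, mul_zero] at hadd
  have h1 : (((⟨t, ht0⟩ + r : ℝ≥0)) : ℝ≥0∞) < sigma Φ u := by
    refine lt_of_le_of_lt ?_ hts
    rw [ENNReal.ofReal_eq_coe_nnreal (by positivity), ENNReal.coe_le_coe, ← NNReal.coe_le_coe]
    have : (r : ℝ) ≤ s := hr
    exact add_le_add_right this t
  have h2 := (haff.lt_sigma_iff ⟨x, hx⟩ hu _).1 h1 _ le_rfl
  exact (mul_ne_zero h2 (Complex.exp_ne_zero _)) hadd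

include hne hspan haff hdist in
/-- The semiflow property of `(φ, ψ)`, again by comparing continuous logarithms, now along the
time interval `[0, s]`. -/
lemma semiflow {u : V d} (hu : u ∈ U D) {t s : ℝ} (ht0 : 0 ≤ t) (hs0 : 0 ≤ s)
    (hts : ENNReal.ofReal (t + s) < sigma Φ u) :
    φ (t + s) u = φ t u + φ s (ψ t u) ∧ ψ (t + s) u = ψ s (ψ t u) := by
  have hlt : ∀ r ≤ t + s, ENNReal.ofReal r < sigma Φ u := fun r hr =>
    (ENNReal.ofReal_le_ofReal hr).trans_lt hts
  have hψ := psi_mem_U haff hdist hu ht0 (hlt t (by linarith))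
  have hσ := lt_sigma_psi hne haff hdist hu ht0 hs0 hts
  obtain ⟨hφ0, hψ0⟩ := initial_values hne hspan haff hdist hψ
  have hmaps : MapsTo (fun r => t + r) (Icc 0 s) (Icc 0 (t + s)) := fun r hr =>
    ⟨by linarith [hr.1], by linarith [hr.2]⟩
  have key : ∀ x ∈ D, (φ (t + s) u - φ t u - φ s (ψ t u))
      + pairing x (ψ (t + s) u - ψ s (ψ t u)) = 0 := by
    intro x hx
    refine eq_zero_of_exp_eq_one (isPreconnected_Icc (a := (0 : ℝ)) (b := s))
      (g := fun r => (φ (t + r) u - φ t u - φ r (ψ t u))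
        + pairing x (ψ (t + r) u - ψ r (ψ t u))) ?_ ?_ (left_mem_Icc.2 hs0) ?_
        (right_mem_Icc.2 hs0)
    · have h1 := (continuousOn_phi_time hdist hu hts).comp (by fun_prop) hmaps
      have h2 := (continuousOn_psi_time hdist hu hts).comp (by fun_prop) hmaps
      have h3 := continuousOn_phi_time hdist hψ hσ
      have h4 := continuousOn_psi_time hdist hψ hσ
      exact ((h1.sub continuousOn_const).sub h3).add
        ((continuous_pairing_right x).comp_continuousOn (h2.sub h4))
    · intro r hr
      have hadd := haff.transform_add ⟨t, ht0⟩ ⟨r, hr.1⟩ ⟨x, hx⟩ hu hψ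
      change Φ (t + r) u * Complex.exp (pairing x (ψ (t + r) u))
        = Φ t u * (Φ r (ψ t u) * Complex.exp (pairing x (ψ r (ψ t u)))) at hadd
      rw [Phi_eq_exp hdist hu (by linarith [hr.1]) (hlt _ (by linarith [hr.2])),
        Phi_eq_exp hdist hu ht0 (hlt _ (by linarith)),
        Phi_eq_exp hdist hψ hr.1 ((ENNReal.ofReal_le_ofReal hr.2).trans_lt hσ),
        ← Complex.exp_add, ← Complex.exp_add, ← Complex.exp_add] at hadd
      have h5 : (φ (t + r) u - φ t u - φ r (ψ t u)) + pairing x (ψ (t + r) u - ψ r (ψ t u))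
          = (φ (t + r) u + pairing x (ψ (t + r) u))
            - (φ t u + (φ r (ψ t u) + pairing x (ψ r (ψ t u)))) := by
        rw [pairing_sub_right]; ring
      rw [h5, Complex.exp_sub, hadd, div_self (Complex.exp_ne_zero _)]
    · simp [hφ0, hψ0]
  obtain ⟨h1, h2⟩ := eq_zero_of_pairing_add hne hspan key
  exact ⟨by linear_combination h1, sub_eq_zero.1 h2⟩

/-- A continuous function whose right derivative is continuous is differentiable. -/
lemma hasDerivWithinAt_of_right {G : Type*} [NormedAddCommGroup G] [NormedSpace ℝ G]
    [CompleteSpace G] {f f' : ℝ → G} {T : ℝ} (hf : ContinuousOn f (Icc 0 T))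
    (hf' : ContinuousOn f' (Icc 0 T))
    (hd : ∀ t ∈ Ico 0 T, HasDerivWithinAt f (f' t) (Ici t) t) {t : ℝ} (ht : t ∈ Ico 0 T) :
    HasDerivWithinAt f (f' t) (Ici 0) t := by
  have hT : 0 ≤ T := ht.1.trans ht.2.le
  have hg : ∀ s ∈ Icc 0 T,
      HasDerivWithinAt (fun s => f 0 + ∫ r in (0 : ℝ)..s, f' r) (f' s) (Icc 0 T) s := by
    intro s hs
    have : Fact (s ∈ Icc 0 T) := ⟨hs⟩
    refine HasDerivWithinAt.const_add _ (intervalIntegral.integral_hasDerivWithinAt_right ?_ ?_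
      (hf' s hs))
    · exact (hf'.mono (Icc_subset_Icc_right hs.2)).intervalIntegrable_of_Icc hs.1
    · exact hf'.stronglyMeasurableAtFilter_nhdsWithin measurableSet_Icc s
  have heq := eq_of_has_deriv_right_eq hd (g := fun s => f 0 + ∫ r in (0 : ℝ)..s, f' r)
    (fun s hs => ((hg s (Ico_subset_Icc_self hs)).mono_of_mem_nhdsWithin
      (Icc_mem_nhdsGE_of_mem hs)))
    hf (fun s hs => (hg s hs).continuousWithinAt) (by simp)
  have h1 : HasDerivWithinAt f (f' t) (Icc 0 T) t :=
    (hg t (Ico_subset_Icc_self ht)).congr heq (heq t (Ico_subset_Icc_self ht))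
  refine h1.mono_of_mem_nhdsWithin ?_
  filter_upwards [self_mem_nhdsWithin, mem_nhdsWithin_of_mem_nhds (Iio_mem_nhds ht.2)] with s hs hs'
  exact ⟨hs, le_of_lt hs'⟩

variable {F : V d → ℂ} {R : V d → V d} (hreg : IsRegular D φ ψ F R)

include hne hspan haff hdist hreg in
/-- The generalized Riccati equations. -/
lemma riccati {u : V d} (hu : u ∈ U D) {t : ℝ} (ht0 : 0 ≤ t)
    (ht : ENNReal.ofReal t < sigma Φ u) :
    HasDerivWithinAt (fun s => φ s u) (F (ψ t u)) (Ici 0) t ∧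
      HasDerivWithinAt (fun s => ψ s u) (R (ψ t u)) (Ici 0) t := by
  obtain ⟨T, htT, hT⟩ := IsAffine.exists_gt_lt_sigma ht0 ht
  have hlt : ∀ r ≤ T, ENNReal.ofReal r < sigma Φ u := fun r hr =>
    (ENNReal.ofReal_le_ofReal hr).trans_lt hT
  have hφc := continuousOn_phi_time hdist hu hT
  have hψc := continuousOn_psi_time hdist hu hT
  -- on `[0, T]` the flow `ψ(·, u)` stays in one of the sets `𝒰_l`
  obtain ⟨l, hl⟩ : ∃ l : ℕ, ∀ s ∈ Icc 0 T, ψ s u ∈ Uk D l := by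
    obtain ⟨k, hk⟩ := mem_U_iff.1 hu
    obtain ⟨C, hC⟩ := isCompact_Icc.exists_bound_of_continuousOn hφc
    obtain ⟨l, hl⟩ := exists_nat_ge (k + C)
    refine ⟨l, fun s hs x hx => ?_⟩
    have h1 := haff.re_pairing_psi_le hk ⟨s, hs.1⟩ ⟨x, hx⟩ (Phi_eq_exp hdist hu hs.1 (hlt s hs.2))
    have h2 := (abs_le.1 ((Complex.abs_re_le_norm _).trans (hC s hs))).1
    have h3 : (pairing x (ψ s u)).re ≤ k - (φ s u).re := h1
    linarith
  have hright : ∀ s ∈ Ico 0 T, HasDerivWithinAt (fun s => φ s u) (F (ψ s u)) (Ici s) s ∧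
      HasDerivWithinAt (fun s => ψ s u) (R (ψ s u)) (Ici s) s := by
    intro s hs
    have hψ := psi_mem_U haff hdist hu hs.1 (hlt s hs.2.le)
    have hev : ∀ᶠ r in 𝓝[≥] s, φ r u = φ s u + φ (r - s) (ψ s u) ∧
        ψ r u = ψ (r - s) (ψ s u) := by
      filter_upwards [self_mem_nhdsWithin, mem_nhdsWithin_of_mem_nhds (Iio_mem_nhds hs.2)]
        with r hr hr'
      have := semiflow hne hspan haff hdist hu hs.1 (sub_nonneg.2 hr)
        (by rw [add_sub_cancel]; exact hlt r (le_of_lt hr'))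
      rwa [add_sub_cancel] at this
    have hsub : HasDerivWithinAt (fun r : ℝ => r - s) 1 (Ici s) s :=
      (hasDerivWithinAt_id s _).sub_const s
    have hmaps : MapsTo (fun r : ℝ => r - s) (Ici s) (Ici (s - s)) := fun r hr =>
      sub_le_sub_right hr s
    constructor
    · have h1 : HasDerivWithinAt (fun r => φ r (ψ s u)) (F (ψ s u)) (Ici (s - s)) (s - s) := by
        simpa using hreg.deriv_phi _ hψ
      have h2 := (HasDerivWithinAt.scomp (h := fun r => r - s) s h1 hsub hmaps).const_add (φ s u)
      rw [one_smul] at h2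
      exact h2.congr_of_eventuallyEq (hev.mono fun r hr => hr.1)
        (by simpa using (hev.self_of_nhdsWithin self_mem_Ici).1)
    · have h1 : HasDerivWithinAt (fun r => ψ r (ψ s u)) (R (ψ s u)) (Ici (s - s)) (s - s) := by
        simpa using hreg.deriv_psi _ hψ
      have h2 := HasDerivWithinAt.scomp (h := fun r => r - s) s h1 hsub hmaps
      rw [one_smul] at h2
      exact h2.congr_of_eventuallyEq (hev.mono fun r hr => hr.2)
        (by simpa using (hev.self_of_nhdsWithin self_mem_Ici).2)
  exact ⟨hasDerivWithinAt_of_right hφc ((hreg.continuousOn_F l).comp hψc hl)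
      (fun s hs => (hright s hs).1) ⟨ht0, htT⟩,
    hasDerivWithinAt_of_right hψc ((hreg.continuousOn_R l).comp hψc hl)
      (fun s hs => (hright s hs).2) ⟨ht0, htT⟩⟩

end Semiflow

end FourierLaplace

/-! ### Imaginary arguments and Lévy measures -/

section Basics

variable {d : ℕ} {D : Set (E d)}

/-- The purely imaginary vector `i y ∈ ℂ^d`. -/
def imag (y : E d) : V d := WithLp.toLp 2 fun j => (y j : ℂ) * Complex.I

@[simp] lemma imag_apply (y : E d) (j : Fin d) : imag y j = (y j : ℂ) * Complex.I := rfl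

@[fun_prop]
lemma continuous_imag : Continuous (imag : E d → V d) := by
  unfold imag; fun_prop

@[simp] lemma imag_zero : imag (0 : E d) = 0 := by ext j; simp

lemma imag_smul (c : ℝ) (y : E d) : imag (c • y) = c • imag y := by
  ext j; simp [mul_assoc]

lemma pairing_imag (ξ y : E d) : pairing ξ (imag y) = (inner ℝ ξ y : ℝ) * Complex.I := by
  simp [pairing, PiLp.inner_apply, Finset.mul_sum, mul_comm, mul_left_comm]

lemma re_pairing_imag (ξ y : E d) : (pairing ξ (imag y)).re = 0 := by simp [pairing_imag]

lemma imag_mem_Uk (k : ℕ) (y : E d) : imag y ∈ Uk D k := fun x _ => by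
  simp [re_pairing_imag]

lemma imag_mem_U (y : E d) : imag y ∈ U D := mem_U_iff.2 ⟨0, imag_mem_Uk 0 y⟩

lemma abs_apply_le_norm (ξ : E d) (i : Fin d) : |ξ i| ≤ ‖ξ‖ := by
  simpa using PiLp.norm_apply_le ξ i

lemma norm_pairing_le_of_abs_le {r : ℝ} {ξ : E d} (h : ∀ i, |ξ i| ≤ r) (u : V d) :
    ‖pairing ξ u‖ ≤ r * ∑ i, ‖u i‖ := by
  rw [pairing, Finset.mul_sum]
  refine (norm_sum_le _ _).trans (Finset.sum_le_sum fun i _ => ?_)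
  rw [norm_mul, Complex.norm_real, Real.norm_eq_abs]
  exact mul_le_mul_of_nonneg_right (h i) (norm_nonneg _)

lemma norm_pairing_le (ξ : E d) (u : V d) : ‖pairing ξ u‖ ≤ ‖ξ‖ * ∑ i, ‖u i‖ :=
  norm_pairing_le_of_abs_le (abs_apply_le_norm ξ) u

lemma measurable_trunc : Measurable (trunc : E d → E d) := by
  unfold trunc
  exact Measurable.ite (measurableSet_le measurable_norm measurable_const) measurable_id
    measurable_const

lemma measurable_pairing_left (u : V d) : Measurable fun ξ : E d => pairing ξ u :=
  (continuous_pairing_left u).measurable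

lemma measurable_lkIntegrand (u : V d) : Measurable (lkIntegrand u : E d → ℂ) := by
  unfold lkIntegrand
  have h1 := (Complex.measurable_exp.comp (measurable_pairing_left u))
  have h2 := (measurable_pairing_left u).comp measurable_trunc
  exact (h1.sub_const 1).sub h2

lemma min_sq_one_nonneg (ξ : E d) : 0 ≤ min (‖ξ‖ ^ 2) 1 := by positivity

namespace IsLevyMeasure

variable {κ : Measure (E d)} (hκ : IsLevyMeasure κ)

include hκ

lemma integrable_min : Integrable (fun ξ : E d => min (‖ξ‖ ^ 2) 1) κ := by
  refine ⟨by fun_prop, ?_⟩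
  rw [hasFiniteIntegral_iff_ofReal (ae_of_all _ min_sq_one_nonneg)]
  exact hκ.2

/-- Functions of the order of `‖ξ‖² ∧ 1` are integrable with respect to a Lévy measure. -/
lemma integrable_of_le {f : E d → ℂ} (hf : Measurable f) {C : ℝ}
    (h : ∀ᵐ ξ ∂κ, ‖f ξ‖ ≤ C * min (‖ξ‖ ^ 2) 1) : Integrable f κ :=
  (hκ.integrable_min.const_mul C).mono' hf.aestronglyMeasurable h

lemma measure_lt_top {A : Set (E d)} {ε : ℝ} (hε : 0 < ε) (hA : ∀ ξ ∈ A, ε ≤ ‖ξ‖) : κ A < ∞ := by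
  have hm : 0 < min (ε ^ 2) 1 := by positivity
  have hsub : A ⊆ {ξ | min (ε ^ 2) 1 ≤ min (‖ξ‖ ^ 2) 1} := fun ξ hξ => by
    have := hA ξ hξ
    simp only [mem_ofPred_eq]
    gcongr
  exact (measure_mono hsub).trans_lt (hκ.integrable_min.measure_ge_lt_top hm)

omit hκ in
lemma zero : IsLevyMeasure (0 : Measure (E d)) := by simp [IsLevyMeasure]

lemma add {κ' : Measure (E d)} (hκ' : IsLevyMeasure κ') : IsLevyMeasure (κ + κ') := by
  refine ⟨by simp [hκ.1, hκ'.1], ?_⟩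
  rw [lintegral_add_measure]
  exact ENNReal.add_lt_top.2 ⟨hκ.2, hκ'.2⟩

lemma smul (r : ℝ≥0) : IsLevyMeasure (r • κ) := by
  refine ⟨by simp [hκ.1], ?_⟩
  rw [lintegral_smul_measure, ENNReal.smul_def, smul_eq_mul]
  exact ENNReal.mul_lt_top ENNReal.coe_lt_top hκ.2

end IsLevyMeasure

lemma norm_exp_mul_I_sub_one_sub_le (s : ℝ) :
    ‖Complex.exp (s * Complex.I) - 1 - s * Complex.I‖ ≤ 3 * s ^ 2 := by
  have hn : ‖(s * Complex.I : ℂ)‖ = |s| := by simp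
  rcases le_or_gt |s| 1 with h | h
  · have := Complex.norm_exp_sub_one_sub_id_le (x := s * Complex.I) (by rwa [hn])
    rw [hn, sq_abs] at this
    nlinarith [sq_nonneg s]
  · refine (norm_sub_le _ _).trans ((add_le_add (norm_sub_le _ _) le_rfl).trans ?_)
    rw [Complex.norm_exp_ofReal_mul_I, hn, norm_one, ← sq_abs s]
    nlinarith

/-- For imaginary arguments the Lévy–Khintchine integrand is of the order of `‖ξ‖² ∧ 1`. -/
lemma norm_lkIntegrand_imag_le (y ξ : E d) :
    ‖lkIntegrand (imag y) ξ‖ ≤ (3 * ‖y‖ ^ 2 + 2) * min (‖ξ‖ ^ 2) 1 := by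
  have hexp : ∀ s : ℝ, ‖Complex.exp (s * Complex.I)‖ = 1 := Complex.norm_exp_ofReal_mul_I
  rcases le_or_gt ‖ξ‖ 1 with h | h
  · have hs : |inner ℝ ξ y| ≤ ‖ξ‖ * ‖y‖ := abs_real_inner_le_norm ξ y
    have h2 : ‖lkIntegrand (imag y) ξ‖ ≤ 3 * (inner ℝ ξ y) ^ 2 := by
      rw [lkIntegrand, trunc, if_pos h, pairing_imag]
      exact norm_exp_mul_I_sub_one_sub_le _
    rw [min_eq_left (by nlinarith [norm_nonneg ξ])]
    have h3 : (inner ℝ ξ y) ^ 2 ≤ (‖ξ‖ * ‖y‖) ^ 2 := sq_le_sq' (abs_le.1 hs).1 (abs_le.1 hs).2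
    nlinarith [sq_nonneg ‖ξ‖, sq_nonneg (‖ξ‖ * ‖y‖)]
  · rw [lkIntegrand, trunc, if_neg (not_le.2 h), pairing_imag, pairing_zero_left, sub_zero,
      min_eq_right (by nlinarith)]
    refine (norm_sub_le _ _).trans ?_
    rw [hexp, norm_one]
    nlinarith [sq_nonneg ‖y‖]

end Basics

/-! ### Second differences of characteristic functions -/

section SecondDifference

open ProbabilityTheory

variable {d : ℕ}

/-- A pointwise bounded sequence of continuous functions with `N(y + z) ≤ 2 (N(y) + N(z))` grows at
most quadratically, uniformly along the sequence: by Baire's theorem it is uniformly bounded on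
some ball, hence on a ball around `0`, and `N(2 z) ≤ 4 N(z)` does the rest. -/
lemma exists_quadratic_bound {N : ℕ → E d → ℝ} (hc : ∀ n, Continuous (N n))
    (hsub : ∀ n y z, N n (y + z) ≤ 2 * (N n y + N n z)) (heven : ∀ n y, N n (-y) = N n y)
    (hb : ∀ y, BddAbove (range fun n => N n y)) :
    ∃ C, ∀ n y, N n y ≤ C * (1 + ‖y‖ ^ 2) := by
  have hclosed : ∀ k : ℕ, IsClosed {y | ∀ n, N n y ≤ k} := fun k => by
    simp only [Set.ofPred_forall]
    exact isClosed_iInter fun n => isClosed_le (hc n) continuous_const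
  have hunion : ⋃ k : ℕ, {y | ∀ n, N n y ≤ k} = univ := eq_univ_of_forall fun y => by
    obtain ⟨B, hB⟩ := hb y
    obtain ⟨k, hk⟩ := exists_nat_ge B
    exact mem_iUnion.2 ⟨k, fun n => (hB (mem_range_self n)).trans hk⟩
  obtain ⟨k, y₀, hy₀⟩ := nonempty_interior_of_iUnion_of_closed hclosed hunion
  obtain ⟨r, hr, hball⟩ := Metric.mem_nhds_iff.1 (mem_interior_iff_mem_nhds.1 hy₀)
  have hk0 : (0 : ℝ) ≤ k := Nat.cast_nonneg k
  have hsmall : ∀ n z, ‖z‖ < r → N n z ≤ 4 * k := by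
    intro n z hz
    have h1 : N n (y₀ + z) ≤ k := hball (by simpa using hz) n
    have h2 : N n y₀ ≤ k := hball (Metric.mem_ball_self hr) n
    have h3 := hsub n (y₀ + z) (-y₀)
    rw [heven, add_neg_cancel_comm] at h3
    linarith
  have hpow : ∀ n (m : ℕ) z, N n ((2 : ℝ) ^ m • z) ≤ 4 ^ m * N n z := by
    intro n m z
    induction m with
    | zero => simp
    | succ m ih =>
      have h := hsub n ((2 : ℝ) ^ m • z) ((2 : ℝ) ^ m • z)
      rw [← two_smul ℝ ((2 : ℝ) ^ m • z), smul_smul, ← pow_succ'] at h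
      rw [pow_succ (4 : ℝ)]
      linarith
  refine ⟨16 * k / r ^ 2 + 4 * k, fun n y => ?_⟩
  have hy2 := sq_nonneg ‖y‖
  have hA : 0 ≤ 16 * k / r ^ 2 := by positivity
  rcases lt_or_ge ‖y‖ r with hy | hy
  · have := hsmall n y hy
    nlinarith [mul_nonneg hA hy2, mul_nonneg hk0 hy2]
  · obtain ⟨m, hm1, hm2⟩ := exists_nat_pow_near (x := ‖y‖ / r) (y := 2)
      ((one_le_div hr).2 hy) one_lt_two
    have h2m : (0 : ℝ) < 2 ^ (m + 1) := by positivity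
    have hz : ‖((2 : ℝ) ^ (m + 1))⁻¹ • y‖ < r := by
      rw [norm_smul, norm_inv, Real.norm_of_nonneg h2m.le, inv_mul_lt_iff₀ h2m]
      exact (div_lt_iff₀ hr).1 hm2
    have h1 := hpow n (m + 1) (((2 : ℝ) ^ (m + 1))⁻¹ • y)
    rw [smul_smul, mul_inv_cancel₀ h2m.ne', one_smul] at h1
    have h3 : (4 : ℝ) ^ m ≤ (‖y‖ / r) ^ 2 := by
      have : (4 : ℝ) ^ m = (2 ^ m) ^ 2 := by rw [← pow_mul, mul_comm, pow_mul]; norm_num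
      rw [this]
      gcongr
    calc N n y ≤ 4 ^ (m + 1) * (4 * k) := h1.trans (by gcongr; exact hsmall n _ hz)
      _ = 16 * k * 4 ^ m := by ring
      _ ≤ 16 * k * (‖y‖ / r) ^ 2 := by gcongr
      _ = 16 * k / r ^ 2 * ‖y‖ ^ 2 := by rw [div_pow]; ring
      _ ≤ _ := by nlinarith

/-- The function `N(y) = ∫ (1 - cos⟨ξ, y⟩) ν(dξ)`. -/
def cosDefect (ν : Measure (E d)) (y : E d) : ℝ := ∫ ξ, (1 - Real.cos (inner ℝ ξ y)) ∂ν

/-- The symmetric second difference of the characteristic function at `y` with step `z`. -/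
def secondDiff (g : E d → ℂ) (y z : E d) : ℂ := g y - g (y + z) / 2 - g (y - z) / 2

lemma exp_secondDiff (ξ y z : E d) :
    secondDiff (fun y => Complex.exp ((inner ℝ ξ y : ℝ) * Complex.I)) y z
      = Complex.exp ((inner ℝ ξ y : ℝ) * Complex.I) * ((1 - Real.cos (inner ℝ ξ z) : ℝ) : ℂ) := by
  simp only [secondDiff, inner_add_right, inner_sub_right]
  push_cast
  rw [Complex.cos, add_mul, sub_mul, Complex.exp_add, Complex.exp_sub, neg_mul, Complex.exp_neg]
  ring

lemma integrable_exp_inner (ν : Measure (E d)) [IsFiniteMeasure ν] (y : E d) :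
    Integrable (fun ξ : E d => Complex.exp ((inner ℝ ξ y : ℝ) * Complex.I)) ν :=
  Integrable.of_bound (by fun_prop) 1 (ae_of_all _ fun ξ => by
    rw [Complex.norm_exp_ofReal_mul_I])

lemma integrable_one_sub_cos (ν : Measure (E d)) [IsFiniteMeasure ν] (y : E d) :
    Integrable (fun ξ : E d => 1 - Real.cos (inner ℝ ξ y)) ν :=
  Integrable.of_bound (by fun_prop) 2 (ae_of_all _ fun ξ => by
    rw [Real.norm_eq_abs, abs_le]
    constructor <;> linarith [Real.cos_le_one (inner ℝ ξ y), Real.neg_one_le_cos (inner ℝ ξ y)])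

lemma secondDiff_charFun (ν : Measure (E d)) [IsFiniteMeasure ν] (y z : E d) :
    secondDiff (charFun ν) y z = ∫ ξ, Complex.exp ((inner ℝ ξ y : ℝ) * Complex.I)
      * ((1 - Real.cos (inner ℝ ξ z) : ℝ) : ℂ) ∂ν := by
  simp_rw [← exp_secondDiff, secondDiff, charFun_apply]
  rw [integral_sub, integral_sub, integral_div, integral_div]
  · exact integrable_exp_inner ν _
  · exact (integrable_exp_inner ν _).div_const 2
  · exact (integrable_exp_inner ν _).sub ((integrable_exp_inner ν _).div_const 2)
  · exact (integrable_exp_inner ν _).div_const 2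

lemma norm_secondDiff_charFun_le (ν : Measure (E d)) [IsFiniteMeasure ν] (y z : E d) :
    ‖secondDiff (charFun ν) y z‖ ≤ cosDefect ν z := by
  rw [secondDiff_charFun]
  refine norm_integral_le_of_norm_le (integrable_one_sub_cos ν z) (ae_of_all _ fun ξ => ?_)
  rw [norm_mul, Complex.norm_exp_ofReal_mul_I, one_mul, Complex.norm_real,
    Real.norm_of_nonneg (sub_nonneg.2 (Real.cos_le_one _))]

lemma cosDefect_neg (ν : Measure (E d)) (y : E d) : cosDefect ν (-y) = cosDefect ν y := by
  simp [cosDefect]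

lemma continuous_cosDefect (ν : Measure (E d)) [IsFiniteMeasure ν] :
    Continuous (cosDefect ν) := by
  refine continuous_of_dominated (bound := fun _ => 2) (fun y => by fun_prop) (fun y => ?_)
    (integrable_const _) (ae_of_all _ fun ξ => by fun_prop)
  refine ae_of_all _ fun ξ => ?_
  rw [Real.norm_eq_abs, abs_le]
  constructor <;> linarith [Real.cos_le_one (inner ℝ ξ y), Real.neg_one_le_cos (inner ℝ ξ y)]

lemma one_sub_cos_add_le (a b : ℝ) :
    1 - Real.cos (a + b) ≤ 2 * ((1 - Real.cos a) + (1 - Real.cos b)) := by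
  rw [Real.cos_add]
  nlinarith [Real.sin_sq_add_cos_sq a, Real.sin_sq_add_cos_sq b, sq_nonneg (Real.sin a - Real.sin b),
    sq_nonneg (Real.cos a - 1 + (Real.cos b - 1)), sq_nonneg (Real.cos a - Real.cos b),
    Real.cos_le_one a, Real.cos_le_one b, Real.neg_one_le_cos a, Real.neg_one_le_cos b,
    mul_nonneg (sub_nonneg.2 (Real.cos_le_one a)) (sub_nonneg.2 (Real.cos_le_one b))]

lemma cosDefect_add_le (ν : Measure (E d)) [IsFiniteMeasure ν] (y z : E d) :
    cosDefect ν (y + z) ≤ 2 * (cosDefect ν y + cosDefect ν z) := by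
  simp_rw [cosDefect]
  rw [← integral_add (integrable_one_sub_cos ν y) (integrable_one_sub_cos ν z),
    ← integral_const_mul]
  refine integral_mono (integrable_one_sub_cos ν _)
    (((integrable_one_sub_cos ν y).add (integrable_one_sub_cos ν z)).const_mul 2) fun ξ => ?_
  simp only [inner_add_right]
  exact one_sub_cos_add_le _ _

lemma re_charFun (ν : Measure (E d)) [IsFiniteMeasure ν] (y : E d) :
    (charFun ν y).re = ν.real univ - cosDefect ν y := by
  have h1 : (charFun ν y).re = ∫ ξ, Real.cos (inner ℝ ξ y) ∂ν := by
    rw [charFun_apply, ← RCLike.re_eq_complex_re, ← integral_re (integrable_exp_inner ν y)]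
    simp [Complex.exp_ofReal_mul_I_re]
  have h2 : Integrable (fun ξ : E d => Real.cos (inner ℝ ξ y)) ν := by
    simpa [Pi.sub_def] using (integrable_const (1 : ℝ)).sub (integrable_one_sub_cos ν y)
  rw [h1, cosDefect, integral_sub (integrable_const _) h2]
  simp

/-! ### The Gaussian weight -/

/-- The weight `w(ξ) = 1 - e^{-‖ξ‖²/2}`, comparable to `‖ξ‖² ∧ 1`. -/
def weight (ξ : E d) : ℝ := 1 - Real.exp (-‖ξ‖ ^ 2 / 2)

@[fun_prop]
lemma continuous_weight : Continuous (weight : E d → ℝ) := by unfold weight; fun_prop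

lemma weight_nonneg (ξ : E d) : 0 ≤ weight ξ :=
  sub_nonneg.2 (Real.exp_le_one_iff.2 (by nlinarith [sq_nonneg ‖ξ‖]))

lemma weight_le_one (ξ : E d) : weight ξ ≤ 1 := by
  unfold weight; linarith [Real.exp_pos (-‖ξ‖ ^ 2 / 2)]

lemma min_le_three_mul_weight (ξ : E d) : min (‖ξ‖ ^ 2) 1 ≤ 3 * weight ξ := by
  set s := ‖ξ‖ ^ 2 with hs
  have hs0 : 0 ≤ s := sq_nonneg _
  have h1 : Real.exp (-s / 2) ≤ 1 / (1 + s / 2) := by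
    rw [neg_div, Real.exp_neg, one_div]
    gcongr
    linarith [Real.add_one_le_exp (s / 2)]
  have h2 : weight ξ ≥ 1 - 1 / (1 + s / 2) := by
    unfold weight; rw [← hs]; linarith
  have h3 : 1 - 1 / (1 + s / 2) = s / (2 + s) := by field_simp; ring
  have h4 : min s 1 ≤ 3 * (s / (2 + s)) := by
    rw [← mul_div_assoc, le_div_iff₀ (by positivity)]
    rcases le_total s 1 with h | h
    · rw [min_eq_left h]; nlinarith
    · rw [min_eq_right h]; linarith
  linarith

lemma weight_pos {ξ : E d} (hξ : ξ ≠ 0) : 0 < weight ξ := by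
  have h1 : 0 < min (‖ξ‖ ^ 2) 1 := by positivity
  have := min_le_three_mul_weight ξ
  linarith

@[simp] lemma weight_zero : weight (0 : E d) = 0 := by simp [weight]

lemma integral_one_sub_cos_stdGaussian (ξ : E d) :
    ∫ z, (1 - Real.cos (inner ℝ ξ z)) ∂(stdGaussian (E d)) = weight ξ := by
  have h : ∀ z : E d, Real.cos (inner ℝ ξ z) = Real.cos (inner ℝ z ξ) := fun z => by
    rw [real_inner_comm]
  simp_rw [h]
  change cosDefect (stdGaussian (E d)) ξ = _
  have h2 := re_charFun (stdGaussian (E d)) ξ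
  rw [charFun_stdGaussian] at h2
  have h3 : (Complex.exp (-(‖ξ‖ : ℂ) ^ 2 / 2)).re = Real.exp (-‖ξ‖ ^ 2 / 2) := by
    rw [← Complex.ofReal_re (Real.exp _)]
    push_cast
    rfl
  rw [h3, probReal_univ] at h2
  unfold weight
  linarith

/-- The measure `w(ξ) ν(dξ)`. -/
def weighted (ν : Measure (E d)) : Measure (E d) :=
  ν.withDensity fun ξ => ENNReal.ofReal (weight ξ)

instance (ν : Measure (E d)) [IsFiniteMeasure ν] : IsFiniteMeasure (weighted ν) :=
  isFiniteMeasure_withDensity_ofReal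
    (Integrable.of_bound (C := 1) (by fun_prop) (ae_of_all _ fun ξ => by
      rw [Real.norm_of_nonneg (weight_nonneg ξ)]; exact weight_le_one ξ)).2

lemma integral_weighted (ν : Measure (E d)) (f : E d → ℂ) :
    ∫ ξ, f ξ ∂(weighted ν) = ∫ ξ, (weight ξ : ℂ) * f ξ ∂ν := by
  rw [weighted, integral_withDensity_eq_integral_toReal_smul (by fun_prop)
    (ae_of_all _ fun _ => ENNReal.ofReal_lt_top)]
  simp [ENNReal.toReal_ofReal (weight_nonneg _)]

/-- The characteristic function of `w(ξ) ν(dξ)` is a Gaussian mean of second differences of the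
characteristic function of `ν`. -/
lemma charFun_weighted (ν : Measure (E d)) [IsFiniteMeasure ν] (y : E d) :
    charFun (weighted ν) y = ∫ z, secondDiff (charFun ν) y z ∂(stdGaussian (E d)) := by
  simp_rw [secondDiff_charFun]
  rw [integral_integral_swap, charFun_apply, integral_weighted]
  · refine integral_congr_ae (ae_of_all _ fun ξ => ?_)
    simp only
    rw [integral_const_mul, integral_complex_ofReal, integral_one_sub_cos_stdGaussian, mul_comm]
  · refine Integrable.of_bound (C := 2) (by fun_prop) (ae_of_all _ fun p => ?_)
    rw [Function.uncurry, norm_mul, Complex.norm_exp_ofReal_mul_I, one_mul, Complex.norm_real,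
      Real.norm_of_nonneg (sub_nonneg.2 (Real.cos_le_one _))]
    linarith [Real.neg_one_le_cos (inner ℝ p.2 p.1)]

/-! ### Weak limits -/

/-- A form of Lévy's continuity theorem for finite measures: the point mass at `0` that is added to
normalize the measures is invisible to test functions vanishing at `0`. -/
lemma exists_weak_limit {ρ : ℕ → Measure (E d)} [∀ n, IsFiniteMeasure (ρ n)] {θ : E d → ℂ}
    (hθ : ContinuousAt θ 0) (h : ∀ y, Tendsto (fun n => charFun (ρ n) y) atTop (𝓝 (θ y))) :
    ∃ ρ' : Measure (E d), IsFiniteMeasure ρ' ∧ ∀ g : E d →ᵇ ℂ, g 0 = 0 →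
      Tendsto (fun n => ∫ ξ, g ξ ∂(ρ n)) atTop (𝓝 (∫ ξ, g ξ ∂ρ')) := by
  let κ : ℕ → ℝ := fun n => 1 + (ρ n).real univ
  have hκpos : ∀ n, 0 < κ n := fun n => by positivity
  have hκlim : Tendsto κ atTop (𝓝 (1 + (θ 0).re)) := by
    have := (Complex.continuous_re.tendsto _).comp (h 0)
    simp only [charFun_zero, Function.comp_def, Complex.ofReal_re] at this
    exact this.const_add 1
  have hκ1 : 1 ≤ 1 + (θ 0).re := ge_of_tendsto' hκlim fun n => by
    simp only [κ]; linarith [measureReal_nonneg (μ := ρ n) (s := univ)]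
  set K := 1 + (θ 0).re
  let m : ℕ → Measure (E d) := fun n => (Real.toNNReal (κ n)⁻¹) • (Measure.dirac 0 + ρ n)
  have hm : ∀ n (f : E d → ℂ), Integrable f (ρ n) →
      ∫ ξ, f ξ ∂(m n) = (κ n : ℂ)⁻¹ * (f 0 + ∫ ξ, f ξ ∂(ρ n)) := by
    intro n f hf
    rw [integral_smul_nnreal_measure, integral_add_measure (integrable_dirac (by simp)) hf,
      integral_dirac, NNReal.smul_def, Real.coe_toNNReal _ (inv_nonneg.2 (hκpos n).le),
      Complex.real_smul, Complex.ofReal_inv]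
  have hprob : ∀ n, IsProbabilityMeasure (m n) := by
    intro n
    constructor
    have h1 : (Measure.dirac (0 : E d) + ρ n) univ = ENNReal.ofReal (κ n) := by
      rw [Measure.add_apply, measure_univ, ENNReal.ofReal_add zero_le_one measureReal_nonneg,
        ENNReal.ofReal_one, ofReal_measureReal]
    rw [Measure.smul_apply, h1, ENNReal.smul_def, smul_eq_mul]
    change ENNReal.ofReal _ * _ = 1
    rw [← ENNReal.ofReal_mul (inv_nonneg.2 (hκpos n).le), inv_mul_cancel₀ (hκpos n).ne',
      ENNReal.ofReal_one]
  have hchar : ∀ y, Tendsto (fun n => charFun (m n) y) atTop (𝓝 ((K : ℂ)⁻¹ * (1 + θ y))) := by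
    intro y
    have h1 : ∀ n, charFun (m n) y = (κ n : ℂ)⁻¹ * (1 + charFun (ρ n) y) := fun n => by
      rw [charFun_apply, hm n _ (integrable_exp_inner _ y)]
      simp [charFun_apply]
    simp_rw [h1]
    refine Tendsto.mul (Tendsto.inv₀ ?_ ?_) ((h y).const_add 1)
    · exact (Complex.continuous_ofReal.tendsto _).comp hκlim
    · exact_mod_cast (zero_lt_one.trans_le hκ1).ne'
  have htight := isTightMeasureSet_of_tendsto_charFun (μ := m)
    (f := fun y => (K : ℂ)⁻¹ * (1 + θ y)) (by fun_prop) hchar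
  let P : ℕ → ProbabilityMeasure (E d) := fun n => ⟨m n, hprob n⟩
  have hcomp : IsCompact (closure (range P)) := isCompact_closure_of_isTightMeasureSet (by
    convert! htight
    ext μ
    exact ⟨fun ⟨_, ⟨n, hn⟩, h⟩ => ⟨n, by rw [← h, ← hn]; rfl⟩,
      fun ⟨n, hn⟩ => ⟨P n, mem_range_self n, hn⟩⟩)
  -- a cluster point of the normalized measures has the limiting characteristic function, so that
  -- Lévy's theorem applies to the whole sequence
  obtain ⟨P', -, hP'⟩ := hcomp.ultrafilter_le_nhds ((hyperfilter ℕ).map P)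
    (.trans (by simp) (monotone_principal subset_closure))
  have hU : (hyperfilter ℕ : Filter ℕ) ≤ atTop := by
    rw [← Nat.cofinite_eq_atTop]; exact hyperfilter_le_cofinite
  have hP'char : ∀ y, charFun (P' : Measure (E d)) y = (K : ℂ)⁻¹ * (1 + θ y) := by
    intro y
    have h1 : Tendsto P (hyperfilter ℕ) (𝓝 P') := hP'
    rw [ProbabilityMeasure.tendsto_iff_forall_integral_rclike_tendsto ℂ] at h1
    have h2 := h1 (BoundedContinuousFunction.innerProbChar y)
    simp_rw [← charFun_eq_integral_innerProbChar] at h2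
    exact tendsto_nhds_unique h2 ((hchar y).mono_left hU)
  have hconv : Tendsto P atTop (𝓝 P') := by
    rw [ProbabilityMeasure.tendsto_iff_tendsto_charFun]
    intro y
    rw [hP'char]
    exact hchar y
  refine ⟨Real.toNNReal K • (P' : Measure (E d)), inferInstance, fun g hg => ?_⟩
  rw [ProbabilityMeasure.tendsto_iff_forall_integral_rclike_tendsto ℂ] at hconv
  have h1 := hconv g
  have h2 : ∀ n, ∫ ξ, g ξ ∂(ρ n) = (κ n : ℂ) * ∫ ξ, g ξ ∂(P n : Measure (E d)) := fun n => by
    change _ = (κ n : ℂ) * ∫ ξ, g ξ ∂(m n)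
    rw [hm n _ (g.integrable _), hg, zero_add, mul_inv_cancel_left₀]
    exact_mod_cast (hκpos n).ne'
  simp_rw [h2]
  rw [integral_smul_nnreal_measure, NNReal.smul_def,
    Real.coe_toNNReal _ (zero_le_one.trans hκ1), Complex.real_smul]
  exact ((Complex.continuous_ofReal.tendsto _).comp hκlim).mul h1

end SecondDifference

/-! ### The compensated exponential with a smooth truncation -/

section Compensated

variable {d : ℕ}

/-- The smooth truncation `ξ ↦ (sin ξ_1, …, sin ξ_d)`. Integrals of the functions `sin ξ_j` and
`sin ξ_j sin ξ_k` are combinations of values of the characteristic exponent, so that they converge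
whenever the exponents do. -/
def sinVec (ξ : E d) : E d := WithLp.toLp 2 fun j => Real.sin (ξ j)

@[simp] lemma sinVec_apply (ξ : E d) (j : Fin d) : sinVec ξ j = Real.sin (ξ j) := rfl

@[fun_prop]
lemma continuous_sinVec : Continuous (sinVec : E d → E d) := by unfold sinVec; fun_prop

/-- The exponential with real part of the exponent cut off at `K`, which is bounded. -/
def cutExp (K : ℝ) (z : ℂ) : ℂ := Complex.exp ((min z.re K : ℝ) + z.im * Complex.I)

@[fun_prop]
lemma continuous_cutExp (K : ℝ) : Continuous (cutExp K) := by unfold cutExp; fun_prop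

lemma cutExp_of_le {K : ℝ} {z : ℂ} (h : z.re ≤ K) : cutExp K z = Complex.exp z := by
  rw [cutExp, min_eq_left h, Complex.re_add_im]

lemma norm_cutExp_le (K : ℝ) (z : ℂ) : ‖cutExp K z‖ ≤ Real.exp K := by
  rw [cutExp, Complex.norm_exp]
  simp

/-- The function `e^{⟨ξ, u⟩} - 1 - ⟨s, u⟩ - ⟨s, u⟩² / 2` with `s = (sin ξ_1, …, sin ξ_d)`, where
the exponential is cut off. -/
def taylorRem (K : ℝ) (u : V d) (ξ : E d) : ℂ :=
  cutExp K (pairing ξ u) - 1 - pairing (sinVec ξ) u - pairing (sinVec ξ) u ^ 2 / 2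

@[fun_prop]
lemma continuous_taylorRem (K : ℝ) (u : V d) : Continuous (taylorRem K u : E d → ℂ) := by
  unfold taylorRem
  have h := continuous_pairing_left u
  have h1 : Continuous fun ξ : E d => cutExp K (pairing ξ u) := (continuous_cutExp K).comp h
  have h2 : Continuous fun ξ : E d => pairing (sinVec ξ) u := h.comp continuous_sinVec
  fun_prop

lemma abs_sub_sin_le {x : ℝ} (hx : |x| ≤ 1) : |x - Real.sin x| ≤ |x| ^ 3 := by
  have h := Real.sin_bound hx
  have h1 : |x - Real.sin x| ≤ |x ^ 3 / 6| + |Real.sin x - (x - x ^ 3 / 6)| := by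
    have := abs_sub (x ^ 3 / 6) (Real.sin x - (x - x ^ 3 / 6))
    refine le_trans (le_of_eq ?_) this
    congr 1; ring
  have h2 : |x ^ 3 / 6| = |x| ^ 3 / 6 := by rw [abs_div, abs_pow]; norm_num
  have h3 : |x| ^ 5 ≤ |x| ^ 3 := pow_le_pow_of_le_one (abs_nonneg x) hx (by norm_num)
  have h4 : 0 ≤ |x| ^ 3 := by positivity
  linarith

lemma norm_pairing_sinVec_le (ξ : E d) (u : V d) :
    ‖pairing (sinVec ξ) u‖ ≤ min ‖ξ‖ 1 * ∑ i, ‖u i‖ :=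
  norm_pairing_le_of_abs_le (fun i => le_min (Real.abs_sin_le_abs.trans (abs_apply_le_norm ξ i))
    (Real.abs_sin_le_one _)) u

lemma norm_pairing_sub_sinVec_le {ξ : E d} (hξ : ‖ξ‖ ≤ 1) (u : V d) :
    ‖pairing ξ u - pairing (sinVec ξ) u‖ ≤ ‖ξ‖ ^ 3 * ∑ i, ‖u i‖ := by
  rw [← pairing_sub_left]
  refine norm_pairing_le_of_abs_le (fun i => ?_) u
  have h := abs_apply_le_norm ξ i
  exact (abs_sub_sin_le (h.trans hξ)).trans (by gcongr)

/-- The remainder is of third order at the origin. -/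
lemma exists_norm_taylorRem_le (u : V d) {K : ℝ} (hK : ∑ i, ‖u i‖ ≤ K) :
    ∃ C, ∀ ξ, ‖taylorRem K u ξ‖ ≤ C * min (‖ξ‖ ^ 3) 1 := by
  set c := ∑ i, ‖u i‖ with hc
  have hc0 : 0 ≤ c := Finset.sum_nonneg fun i _ => norm_nonneg _
  refine ⟨c ^ 3 * Real.exp c + c + c ^ 2 + (Real.exp K + 1), fun ξ => ?_⟩
  set z := pairing ξ u with hz
  set s := pairing (sinVec ξ) u with hs
  rcases le_or_gt ‖ξ‖ 1 with h | h
  · have hzn : ‖z‖ ≤ ‖ξ‖ * c := norm_pairing_le ξ u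
    have hzc : ‖z‖ ≤ c := hzn.trans (mul_le_of_le_one_left hc0 h)
    have hsn : ‖s‖ ≤ ‖ξ‖ * c :=
      (norm_pairing_sinVec_le ξ u).trans (by gcongr; exact min_le_left _ _)
    have hzs : ‖z - s‖ ≤ ‖ξ‖ ^ 3 * c := norm_pairing_sub_sinVec_le h u
    have hexp : ‖Complex.exp z - 1 - z - z ^ 2 / 2‖ ≤ ‖ξ‖ ^ 3 * (c ^ 3 * Real.exp c) := by
      have h1 := Complex.norm_exp_sub_sum_le_norm_mul_exp z 3
      simp only [Finset.sum_range_succ, Finset.sum_range_zero, pow_zero, Nat.factorial, pow_one,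
        zero_add, Nat.cast_one, div_one, mul_one] at h1
      have h2 : Complex.exp z - 1 - z - z ^ 2 / 2 =
          Complex.exp z - (1 + z + z ^ 2 / ((1 + 1 : ℕ) : ℂ)) := by push_cast; ring
      rw [h2]
      calc _ ≤ ‖z‖ ^ 3 * Real.exp ‖z‖ := by simpa using h1
        _ ≤ (‖ξ‖ * c) ^ 3 * Real.exp c := by gcongr
        _ = _ := by ring
    have hsq : ‖(z ^ 2 - s ^ 2) / 2‖ ≤ ‖ξ‖ ^ 3 * c ^ 2 := by
      have h1 : (z ^ 2 - s ^ 2) / 2 = (z - s) * ((z + s) / 2) := by ring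
      have h2 : ‖(z + s) / 2‖ ≤ c := by
        rw [norm_div, Complex.norm_ofNat, div_le_iff₀ two_pos]
        have := hsn.trans (mul_le_of_le_one_left hc0 h)
        exact (norm_add_le _ _).trans (by linarith)
      rw [h1, norm_mul]
      calc _ ≤ (‖ξ‖ ^ 3 * c) * c := by gcongr
        _ = _ := by ring
    have hrem : taylorRem K u ξ =
        (Complex.exp z - 1 - z - z ^ 2 / 2) + (z - s) + (z ^ 2 - s ^ 2) / 2 := by
      rw [taylorRem, cutExp_of_le ((Complex.re_le_norm _).trans (hzc.trans hK))]
      ring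
    rw [hrem, min_eq_left (pow_le_one₀ (norm_nonneg _) h)]
    refine (norm_add₃_le).trans ?_
    have h3 : 0 ≤ ‖ξ‖ ^ 3 * (Real.exp K + 1) := by positivity
    linarith
  · have hsn : ‖s‖ ≤ c :=
      (norm_pairing_sinVec_le ξ u).trans (mul_le_of_le_one_left hc0 (min_le_right _ _))
    rw [min_eq_right (one_le_pow₀ h.le), mul_one, taylorRem]
    refine (norm_sub_le _ _).trans ?_
    have h1 : ‖cutExp K z - 1 - s‖ ≤ Real.exp K + 1 + c := by
      refine (norm_sub_le _ _).trans (add_le_add ((norm_sub_le _ _).trans ?_) hsn)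
      rw [norm_one]
      linarith [norm_cutExp_le K z]
    have h2 : ‖s ^ 2 / 2‖ ≤ c ^ 2 := by
      rw [norm_div, norm_pow, Complex.norm_ofNat]
      have : ‖s‖ ^ 2 ≤ c ^ 2 := by gcongr
      linarith [sq_nonneg ‖s‖]
    have h3 : 0 ≤ c ^ 3 * Real.exp c := by positivity
    linarith

/-- `taylorRem / w` extends by `0` to a bounded continuous function on `ℝ^d`. With the convention
`0 / 0 = 0` the quotient already is this extension. -/
lemma exists_boundedContinuous_taylorRem (u : V d) {K : ℝ} (hK : ∑ i, ‖u i‖ ≤ K) :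
    ∃ g : E d →ᵇ ℂ, g 0 = 0 ∧ ∀ ξ, (weight ξ : ℂ) * g ξ = taylorRem K u ξ := by
  obtain ⟨C, hC⟩ := exists_norm_taylorRem_le u hK
  have hbound : ∀ ξ : E d, ‖taylorRem K u ξ / weight ξ‖ ≤ 3 * |C| * min ‖ξ‖ 1 := by
    intro ξ
    rcases eq_or_ne ξ 0 with rfl | hξ
    · simp
    rw [norm_div, Complex.norm_real, Real.norm_of_nonneg (weight_nonneg ξ),
      div_le_iff₀ (weight_pos hξ)]
    have h1 : min (‖ξ‖ ^ 3) 1 = min ‖ξ‖ 1 * min (‖ξ‖ ^ 2) 1 := by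
      rcases le_total ‖ξ‖ 1 with h | h
      · rw [min_eq_left h, min_eq_left (pow_le_one₀ (norm_nonneg _) h),
          min_eq_left (pow_le_one₀ (norm_nonneg _) h)]
        ring
      · rw [min_eq_right h, min_eq_right (one_le_pow₀ h), min_eq_right (one_le_pow₀ h), one_mul]
    have h2 : 0 ≤ min ‖ξ‖ 1 := le_min (norm_nonneg _) zero_le_one
    calc ‖taylorRem K u ξ‖ ≤ C * min (‖ξ‖ ^ 3) 1 := hC ξ
      _ ≤ |C| * min (‖ξ‖ ^ 3) 1 := by gcongr; exact le_abs_self C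
      _ = |C| * min ‖ξ‖ 1 * min (‖ξ‖ ^ 2) 1 := by rw [h1]; ring
      _ ≤ |C| * min ‖ξ‖ 1 * (3 * weight ξ) := by gcongr; exact min_le_three_mul_weight ξ
      _ = _ := by ring
  have hcont : Continuous fun ξ : E d => taylorRem K u ξ / weight ξ := by
    refine continuous_iff_continuousAt.2 fun ξ => ?_
    rcases eq_or_ne ξ 0 with rfl | hξ
    · have h0 : Tendsto (fun ξ : E d => 3 * |C| * min ‖ξ‖ 1) (𝓝 0) (𝓝 0) := by
        have : Continuous fun ξ : E d => 3 * |C| * min ‖ξ‖ 1 := by fun_prop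
        simpa using this.tendsto 0
      rw [ContinuousAt, weight_zero, Complex.ofReal_zero, div_zero]
      exact squeeze_zero_norm hbound h0
    · refine ContinuousAt.div (by fun_prop) (by fun_prop) ?_
      exact_mod_cast (weight_pos hξ).ne'
  refine ⟨BoundedContinuousFunction.ofNormedAddCommGroup _ hcont (3 * |C|) fun ξ =>
    (hbound ξ).trans (mul_le_of_le_one_right (by positivity) (min_le_right _ _)), ?_, fun ξ => ?_⟩
  · simp
  · change (weight ξ : ℂ) * (taylorRem K u ξ / weight ξ) = _
    rcases eq_or_ne ξ 0 with rfl | hξ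
    · have := hC 0
      simp only [norm_zero, ne_eq, OfNat.ofNat_ne_zero, not_false_eq_true, zero_pow,
        zero_le_one, min_eq_left, mul_zero, norm_le_zero_iff] at this
      simp [this]
    · rw [mul_div_cancel₀]
      exact_mod_cast (weight_pos hξ).ne'

lemma quadForm_eq_sum_mul (A : Matrix (Fin d) (Fin d) ℝ) (u : V d) :
    quadForm A u = ∑ i, ∑ j, (A i j : ℂ) * (u i * u j) := by
  unfold quadForm
  exact Finset.sum_congr rfl fun i _ => Finset.sum_congr rfl fun j _ => by ring

lemma pairing_sq (ξ : E d) (u : V d) :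
    pairing ξ u ^ 2 = ∑ i, ∑ j, ((ξ i * ξ j : ℝ) : ℂ) * (u i * u j) := by
  rw [sq, pairing, Finset.sum_mul_sum]
  refine Finset.sum_congr rfl fun i _ => Finset.sum_congr rfl fun j _ => ?_
  push_cast
  ring

/-- Integrals of linear and quadratic functions of a vector-valued function. -/
lemma integral_pairing {κ : Measure (E d)} {f : E d → E d}
    (hf : ∀ i, Integrable (fun ξ => f ξ i) κ) (u : V d) :
    Integrable (fun ξ => pairing (f ξ) u) κ ∧
      ∫ ξ, pairing (f ξ) u ∂κ = pairing (WithLp.toLp 2 fun i => ∫ ξ, f ξ i ∂κ) u := by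
  have h : ∀ i ∈ Finset.univ, Integrable (fun ξ => ((f ξ i : ℝ) : ℂ) * u i) κ := fun i _ =>
    (hf i).ofReal.mul_const (u i)
  refine ⟨integrable_finsetSum _ h, ?_⟩
  simp only [pairing]
  rw [integral_finsetSum _ h]
  exact Finset.sum_congr rfl fun i _ => by rw [integral_mul_const, integral_complex_ofReal]

lemma integral_pairing_sq {κ : Measure (E d)} {f : E d → E d}
    (hf : ∀ i j, Integrable (fun ξ => f ξ i * f ξ j) κ) (u : V d) :
    Integrable (fun ξ => pairing (f ξ) u ^ 2) κ ∧
      ∫ ξ, pairing (f ξ) u ^ 2 ∂κ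
        = quadForm (Matrix.of fun i j => ∫ ξ, f ξ i * f ξ j ∂κ) u := by
  have h : ∀ i j, Integrable (fun ξ => ((f ξ i * f ξ j : ℝ) : ℂ) * (u i * u j)) κ := fun i j =>
    (hf i j).ofReal.mul_const _
  simp only [pairing_sq]
  refine ⟨integrable_finsetSum _ fun i _ => integrable_finsetSum _ fun j _ => h i j, ?_⟩
  rw [integral_finsetSum _ fun i _ => integrable_finsetSum _ fun j _ => h i j, quadForm_eq_sum_mul]
  refine Finset.sum_congr rfl fun i _ => ?_
  rw [integral_finsetSum _ fun j _ => h i j]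
  refine Finset.sum_congr rfl fun j _ => ?_
  rw [integral_mul_const, integral_complex_ofReal]
  rfl

end Compensated

/-! ### Limits of exponents of compound Poisson type are of Lévy–Khintchine form -/

section Existence

open ProbabilityTheory

variable {d : ℕ}

/-- If the characteristic functions of finite measures `ν_n` converge to a continuous function, up
to additive constants, then the measures `w(ξ) ν_n(dξ)` converge weakly away from the origin. -/
lemma exists_weighted_limit {ν : ℕ → Measure (E d)} [∀ n, IsFiniteMeasure (ν n)] {χ : E d → ℂ}
    (hχ : Continuous χ) {κ : ℕ → ℂ}
    (h : ∀ y, Tendsto (fun n => charFun (ν n) y - κ n) atTop (𝓝 (χ y))) :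
    ∃ ρ : Measure (E d), IsFiniteMeasure ρ ∧ ∀ g : E d →ᵇ ℂ, g 0 = 0 →
      Tendsto (fun n => ∫ ξ, g ξ ∂(weighted (ν n))) atTop (𝓝 (∫ ξ, g ξ ∂ρ)) := by
  have hsd : ∀ y z, Tendsto (fun n => secondDiff (charFun (ν n)) y z) atTop
      (𝓝 (secondDiff χ y z)) := by
    intro y z
    have h1 := ((h y).sub ((h (y + z)).div_const 2)).sub ((h (y - z)).div_const 2)
    refine h1.congr fun n => ?_
    unfold secondDiff
    ring
  obtain ⟨C, hC⟩ : ∃ C, ∀ n y, cosDefect (ν n) y ≤ C * (1 + ‖y‖ ^ 2) := by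
    refine exists_quadratic_bound (fun n => continuous_cosDefect (ν n))
      (fun n => cosDefect_add_le (ν n)) (fun n => cosDefect_neg (ν n)) fun y => ?_
    have h1 : Tendsto (fun n => cosDefect (ν n) y) atTop (𝓝 ((χ 0 - χ y).re)) := by
      refine ((Complex.continuous_re.tendsto _).comp ((h 0).sub (h y))).congr fun n => ?_
      simp [re_charFun, charFun_zero]
    exact h1.bddAbove_range
  have hint : Integrable (fun z : E d => C * (1 + ‖z‖ ^ 2)) (stdGaussian (E d)) :=
    ((integrable_const 1).add
      ((memLp_two_iff_integrable_sq_norm (by fun_prop)).1 (IsGaussian.memLp_two_id))).const_mul C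
  have hbound : ∀ n y z, ‖secondDiff (charFun (ν n)) y z‖ ≤ C * (1 + ‖z‖ ^ 2) := fun n y z =>
    (norm_secondDiff_charFun_le (ν n) y z).trans (hC n z)
  have hsdc : ∀ {g : E d → ℂ}, Continuous g → Continuous fun p : E d × E d =>
      secondDiff g p.1 p.2 := fun hg => by unfold secondDiff; fun_prop
  refine exists_weak_limit (θ := fun y => ∫ z, secondDiff χ y z ∂(stdGaussian (E d))) ?_ fun y => ?_
  · refine Continuous.continuousAt (continuous_of_dominated
      (bound := fun z => C * (1 + ‖z‖ ^ 2)) (fun y => ?_) (fun y => ae_of_all _ fun z => ?_) hint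
      (ae_of_all _ fun z => ?_))
    · exact ((hsdc hχ).comp (by fun_prop : Continuous fun z => (y, z))).aestronglyMeasurable
    · exact le_of_tendsto' (hsd y z).norm fun n => hbound n y z
    · exact (hsdc hχ).comp (by fun_prop : Continuous fun y => (y, z))
  · simp_rw [charFun_weighted]
    refine tendsto_integral_of_dominated_convergence (fun z => C * (1 + ‖z‖ ^ 2)) (fun n => ?_) hint
      (fun n => ae_of_all _ fun z => hbound n y z) (ae_of_all _ fun z => hsd y z)
    have hcf : Continuous (charFun (ν n)) := by fun_prop
    exact ((hsdc hcf).comp (by fun_prop : Continuous fun z => (y, z))).aestronglyMeasurable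

/-- The measure `1_{ξ ≠ 0} w(ξ)⁻¹ ρ(dξ)`. -/
def unweighted (ρ : Measure (E d)) : Measure (E d) :=
  (ρ.restrict {0}ᶜ).withDensity fun ξ => ENNReal.ofReal (weight ξ)⁻¹

lemma unweighted_absolutelyContinuous (ρ : Measure (E d)) : unweighted ρ ≪ ρ :=
  (withDensity_absolutelyContinuous _ _).trans Measure.restrict_le_self.absolutelyContinuous

lemma measurable_weight : Measurable (weight : E d → ℝ) := continuous_weight.measurable

lemma isLevyMeasure_unweighted (ρ : Measure (E d)) [IsFiniteMeasure ρ] :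
    IsLevyMeasure (unweighted ρ) := by
  constructor
  · exact withDensity_absolutelyContinuous _ _ (by simp [Measure.restrict_apply])
  · have hw := measurable_weight (d := d)
    rw [unweighted, lintegral_withDensity_eq_lintegral_mul _ (by fun_prop) (by fun_prop)]
    refine lt_of_le_of_lt (lintegral_mono (g := fun _ => ENNReal.ofReal 3) fun ξ => ?_) ?_
    · rw [Pi.mul_apply, ← ENNReal.ofReal_mul (inv_nonneg.2 (weight_nonneg ξ))]
      refine ENNReal.ofReal_le_ofReal ?_
      rcases eq_or_ne ξ 0 with rfl | hξ
      · simp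
      · rw [inv_mul_le_iff₀ (weight_pos hξ), mul_comm]
        exact min_le_three_mul_weight ξ
    · rw [lintegral_const]
      exact ENNReal.mul_lt_top ENNReal.ofReal_lt_top (measure_lt_top _ _)

lemma integral_unweighted (ρ : Measure (E d)) {f g : E d → ℂ} (hg : g 0 = 0)
    (h : ∀ ξ, (weight ξ : ℂ) * g ξ = f ξ) : ∫ ξ, f ξ ∂(unweighted ρ) = ∫ ξ, g ξ ∂ρ := by
  have hw := measurable_weight (d := d)
  rw [unweighted, integral_withDensity_eq_integral_toReal_smul (by fun_prop)
    (ae_of_all _ fun _ => ENNReal.ofReal_lt_top)]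
  have h1 : ∫ ξ in {0}ᶜ, g ξ ∂ρ = ∫ ξ, g ξ ∂ρ :=
    setIntegral_eq_integral_of_forall_compl_eq_zero fun ξ hξ => by
      rw [mem_singleton_iff.1 (notMem_compl_iff.1 hξ), hg]
  rw [← h1]
  refine setIntegral_congr_fun (measurableSet_singleton 0).compl fun ξ hξ => ?_
  have hwξ := weight_pos hξ
  simp only [ENNReal.toReal_ofReal (inv_nonneg.2 hwξ.le), Complex.real_smul, ← h,
    Complex.ofReal_inv]
  rw [inv_mul_cancel_left₀]
  exact_mod_cast hwξ.ne'

/-- Half-spaces `{Re⟨ξ, u⟩ ≤ K}` with `K ≥ 0` that carry the measures `ν_n` carry the limit, too. -/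
lemma ae_le_of_weighted_limit {ν : ℕ → Measure (E d)} {ρ : Measure (E d)} [IsFiniteMeasure ρ]
    (hρ : ∀ g : E d →ᵇ ℂ, g 0 = 0 →
      Tendsto (fun n => ∫ ξ, g ξ ∂(weighted (ν n))) atTop (𝓝 (∫ ξ, g ξ ∂ρ)))
    {u : V d} {K : ℝ} (hK : 0 ≤ K) (h : ∀ n, ∀ᵐ ξ ∂(ν n), (pairing ξ u).re ≤ K) :
    ∀ᵐ ξ ∂ρ, (pairing ξ u).re ≤ K := by
  let f : E d → ℝ := fun ξ => min (max ((pairing ξ u).re - K) 0) 1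
  have hf0 : ∀ ξ, 0 ≤ f ξ := fun ξ => le_min (le_max_right _ _) zero_le_one
  have hf1 : ∀ ξ, f ξ ≤ 1 := fun ξ => min_le_right _ _
  have hp := continuous_pairing_left u
  have hfc : Continuous f := by fun_prop
  have hfz : ∀ ξ, f ξ = 0 ↔ (pairing ξ u).re ≤ K := fun ξ => by
    constructor
    · intro h0
      by_contra! hlt
      have : 0 < f ξ := lt_min (lt_max_of_lt_left (by linarith)) one_pos
      exact this.ne' h0
    · intro hle
      simp only [f]
      rw [max_eq_right (by linarith), min_eq_left zero_le_one]
  let g : E d →ᵇ ℂ := BoundedContinuousFunction.ofNormedAddCommGroup (fun ξ => (f ξ : ℂ))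
    (by fun_prop) 1 fun ξ => by
      rw [Complex.norm_real, Real.norm_of_nonneg (hf0 ξ)]; exact hf1 ξ
  have hlim := hρ g (by
    change ((f 0 : ℝ) : ℂ) = 0
    rw [(hfz 0).2 (by simpa using hK), Complex.ofReal_zero])
  have hzero : ∀ n, ∫ ξ, g ξ ∂(weighted (ν n)) = 0 := fun n => by
    refine integral_eq_zero_of_ae ?_
    filter_upwards [(withDensity_absolutelyContinuous _ _).ae_le (h n)] with ξ hξ
    change ((f ξ : ℝ) : ℂ) = 0
    rw [(hfz ξ).2 hξ, Complex.ofReal_zero]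
  simp_rw [hzero] at hlim
  have h0 : ∫ ξ, g ξ ∂ρ = 0 := tendsto_nhds_unique hlim tendsto_const_nhds |>.symm ▸ rfl
  have h1 : ∫ ξ, f ξ ∂ρ = 0 := by
    have h2 : ∫ ξ, ((f ξ : ℝ) : ℂ) ∂ρ = 0 := h0
    rw [integral_complex_ofReal] at h2
    exact_mod_cast h2
  rw [integral_eq_zero_iff_of_nonneg hf0 (Integrable.of_bound (C := 1)
    hfc.aestronglyMeasurable (ae_of_all _ fun ξ => by
      rw [Real.norm_of_nonneg (hf0 ξ)]; exact hf1 ξ))] at h1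
  filter_upwards [h1] with ξ hξ
  exact (hfz ξ).1 hξ

/-- A Lévy–Khintchine representation with a smooth truncation and with the second-order term of the
compensator included can be rewritten with the truncation function `h`. -/
lemma lk_of_taylorRem {κ : Measure (E d)} (hκ : IsLevyMeasure κ)
    (A : Matrix (Fin d) (Fin d) ℝ) (b : E d) (c : ℝ) {S : Set (V d)} {η : V d → ℂ}
    (h : ∀ u ∈ S, ∃ K : ℝ, (∑ i, ‖u i‖ ≤ K) ∧ (∀ᵐ ξ ∂κ, (pairing ξ u).re ≤ K) ∧
      η u = 1 / 2 * quadForm A u + pairing b u - c + ∫ ξ, taylorRem K u ξ ∂κ) :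
    ∀ u ∈ S, Integrable (lkIntegrand u) κ ∧
      η u = 1 / 2 * quadForm (A - Matrix.of fun i j => ∫ ξ, sinVec ξ i * sinVec ξ j ∂κ) u
        + pairing (b - WithLp.toLp 2 fun i => ∫ ξ, (sinVec ξ - trunc ξ) i ∂κ) u - c
        + ∫ ξ, lkIntegrand u ξ ∂κ := by
  intro u hu
  obtain ⟨K, hK, hae, hη⟩ := h u hu
  have hreal : ∀ f : E d → ℝ, Measurable f → (∀ ξ, |f ξ| ≤ min (‖ξ‖ ^ 2) 1) → Integrable f κ :=
    fun f hf hb => hκ.integrable_min.mono' hf.aestronglyMeasurable (ae_of_all _ hb)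
  have hs : Measurable (sinVec : E d → E d) := continuous_sinVec.measurable
  have ht := measurable_trunc (d := d)
  have h1 : ∀ i, Integrable (fun ξ => (sinVec ξ - trunc ξ) i) κ := fun i => by
    refine hreal _ (by fun_prop) fun ξ => ?_
    have hi := abs_apply_le_norm ξ i
    rcases le_or_gt ‖ξ‖ 1 with h | h
    · rw [PiLp.sub_apply, trunc, if_pos h, sinVec_apply, abs_sub_comm,
        min_eq_left (pow_le_one₀ (norm_nonneg _) h)]
      refine (abs_sub_sin_le (hi.trans h)).trans ?_
      calc |ξ i| ^ 3 ≤ |ξ i| ^ 2 :=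
            pow_le_pow_of_le_one (abs_nonneg _) (hi.trans h) (by norm_num)
        _ ≤ ‖ξ‖ ^ 2 := by gcongr
    · rw [PiLp.sub_apply, trunc, if_neg (not_le.2 h), sinVec_apply,
        min_eq_right (one_le_pow₀ h.le)]
      simpa using Real.abs_sin_le_one (ξ i)
  have h2 : ∀ i j, Integrable (fun ξ => sinVec ξ i * sinVec ξ j) κ := fun i j => by
    refine hreal _ (by fun_prop) fun ξ => ?_
    simp only [sinVec_apply, abs_mul]
    have hi := Real.abs_sin_le_abs (x := ξ i) |>.trans (abs_apply_le_norm ξ i)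
    have hj := Real.abs_sin_le_abs (x := ξ j) |>.trans (abs_apply_le_norm ξ j)
    refine le_min ?_ (mul_le_one₀ (Real.abs_sin_le_one _) (abs_nonneg _) (Real.abs_sin_le_one _))
    rw [sq]
    gcongr
  obtain ⟨C, hC⟩ := exists_norm_taylorRem_le u hK
  have h3 : Integrable (taylorRem K u) κ := by
    refine hκ.integrable_of_le (continuous_taylorRem K u).measurable (C := |C|)
      (ae_of_all _ fun ξ => (hC ξ).trans ?_)
    have hmin : min (‖ξ‖ ^ 3) 1 ≤ min (‖ξ‖ ^ 2) 1 := by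
      rcases le_total ‖ξ‖ 1 with h | h
      · exact min_le_min_right _ (pow_le_pow_of_le_one (norm_nonneg _) h (by norm_num))
      · rw [min_eq_right (one_le_pow₀ h), min_eq_right (one_le_pow₀ h)]
    exact mul_le_mul (le_abs_self C) hmin (by positivity) (abs_nonneg C)
  obtain ⟨h4, h4'⟩ := integral_pairing h1 u
  obtain ⟨h5, h5'⟩ := integral_pairing_sq h2 u
  have hlk : lkIntegrand u =ᵐ[κ] fun ξ => taylorRem K u ξ + pairing (sinVec ξ - trunc ξ) u
      + pairing (sinVec ξ) u ^ 2 / 2 := by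
    filter_upwards [hae] with ξ hξ
    rw [lkIntegrand, taylorRem, cutExp_of_le hξ, pairing_sub_left]
    ring
  have h34 : Integrable (fun ξ => taylorRem K u ξ + pairing (sinVec ξ - trunc ξ) u) κ := h3.add h4
  refine ⟨(h34.add (h5.div_const 2)).congr hlk.symm, ?_⟩
  have hsum : ∫ ξ, lkIntegrand u ξ ∂κ = ∫ ξ, taylorRem K u ξ ∂κ
      + pairing (WithLp.toLp 2 fun i => ∫ ξ, (sinVec ξ - trunc ξ) i ∂κ) u
      + quadForm (Matrix.of fun i j => ∫ ξ, sinVec ξ i * sinVec ξ j ∂κ) u / 2 := by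
    rw [integral_congr_ae hlk, integral_add h34 (h5.div_const 2), integral_add h3 h4, h4',
      integral_div, h5']
  have hquad : ∀ A B : Matrix (Fin d) (Fin d) ℝ,
      quadForm (A - B) u = quadForm A u - quadForm B u := fun A B => by
    simp [quadForm_eq_sum_mul, sub_mul, Finset.sum_sub_distrib]
  rw [hη, hsum, hquad, pairing_sub_left]
  ring

/-- A limit of exponents `∫ (e^{⟨ξ, u⟩} - 1) ν_n(dξ) - c_n` is of Lévy–Khintchine form if it is
continuous at imaginary arguments. -/
theorem exists_levyKhintchine {S : Set (V d)} (hS : ∀ y, imag y ∈ S) {ν : ℕ → Measure (E d)}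
    [∀ n, IsFiniteMeasure (ν n)]
    (hsupp : ∀ u ∈ S, ∃ K : ℝ, ∀ n, ∀ᵐ ξ ∂(ν n), (pairing ξ u).re ≤ K)
    {c : ℕ → ℝ} {η : V d → ℂ} (hη : Continuous fun y => η (imag y))
    (hlim : ∀ u ∈ S, Tendsto (fun n => ∫ ξ, (Complex.exp (pairing ξ u) - 1) ∂(ν n) - c n) atTop
      (𝓝 (η u))) :
    ∃ (a : Matrix (Fin d) (Fin d) ℝ) (b : E d) (c : ℝ) (κ : Measure (E d)),
      a.IsSymm ∧ IsLevyMeasure κ ∧ ∀ u ∈ S, Integrable (lkIntegrand u) κ ∧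
        η u = 1 / 2 * quadForm a u + pairing b u - c + ∫ ξ, lkIntegrand u ξ ∂κ := by
  -- the exponents at imaginary arguments
  have hchar : ∀ n y, ∫ ξ, (Complex.exp (pairing ξ (imag y)) - 1) ∂(ν n) - c n
      = charFun (ν n) y - ((ν n).real univ + c n) := fun n y => by
    simp_rw [pairing_imag]
    rw [integral_sub (integrable_exp_inner _ _) (integrable_const _), charFun_apply]
    simp
    ring
  have hlimchar : ∀ y, Tendsto (fun n => charFun (ν n) y - ((ν n).real univ + c n)) atTop
      (𝓝 (η (imag y))) := fun y => by
    simpa only [hchar] using hlim (imag y) (hS y)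
  obtain ⟨ρ, hρfin, hρ⟩ := exists_weighted_limit hη hlimchar
  have hre : ∀ y, Tendsto (fun n => cosDefect (ν n) y) atTop
      (𝓝 ((η (imag 0)).re - (η (imag y)).re)) := fun y => by
    refine ((Complex.continuous_re.tendsto _).comp
      ((hlimchar 0).sub (hlimchar y))).congr fun n => ?_
    simp [re_charFun, charFun_zero]
    ring
  have hc : Tendsto c atTop (𝓝 (-(η (imag 0)).re)) := by
    refine ((Complex.continuous_re.tendsto _).comp (hlimchar 0)).neg.congr fun n => ?_
    simp [charFun_zero]
  -- the integrals of the smooth truncation converge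
  have hsin : ∀ y, Tendsto (fun n => ∫ ξ, Real.sin (inner ℝ ξ y) ∂(ν n)) atTop
      (𝓝 (η (imag y)).im) := fun y => by
    refine ((Complex.continuous_im.tendsto _).comp (hlimchar y)).congr fun n => ?_
    have h1 := integral_im (integrable_exp_inner (ν n) y)
    simp only [RCLike.im_eq_complex_im, Complex.exp_ofReal_mul_I_im] at h1
    simp [charFun_apply, h1]
  let e : Fin d → E d := fun i => EuclideanSpace.single i 1
  have he : ∀ (ξ : E d) i, inner ℝ ξ (e i) = ξ i := fun ξ i => by
    simp [e, EuclideanSpace.inner_single_right]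
  have hb : ∀ i, Tendsto (fun n => ∫ ξ, sinVec ξ i ∂(ν n)) atTop (𝓝 (η (imag (e i))).im) :=
    fun i => by simpa only [he, sinVec_apply] using hsin (e i)
  have hcosint : ∀ n y, Integrable (fun ξ : E d => 1 - Real.cos (inner ℝ ξ y)) (ν n) :=
    fun n y => integrable_one_sub_cos (ν n) y
  let A : Matrix (Fin d) (Fin d) ℝ := Matrix.of fun i j =>
    ((η (imag (e i - e j))).re - (η (imag (e i + e j))).re) / 2
  have hA : ∀ i j, Tendsto (fun n => ∫ ξ, sinVec ξ i * sinVec ξ j ∂(ν n)) atTop (𝓝 (A i j)) := by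
    intro i j
    have h1 := ((hre (e i + e j)).sub (hre (e i - e j))).div_const 2
    have h2 : ((η (imag 0)).re - (η (imag (e i + e j))).re
        - ((η (imag 0)).re - (η (imag (e i - e j))).re)) / 2 = A i j := by
      simp only [A, Matrix.of_apply]; ring
    rw [h2] at h1
    refine h1.congr fun n => ?_
    rw [cosDefect, cosDefect, ← integral_sub (hcosint _ _) (hcosint _ _), ← integral_div]
    refine integral_congr_ae (ae_of_all _ fun ξ => ?_)
    simp only [inner_add_right, inner_sub_right, he, sinVec_apply, Real.cos_add, Real.cos_sub]
    ring
  have hAsymm : A.IsSymm := by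
    ext i j
    simp only [A, Matrix.transpose_apply, Matrix.of_apply]
    have h1 : imag (e j - e i) = -imag (e i - e j) := by
      ext k; simp [← neg_mul]
    have h2 : (η (imag (e j - e i))).re = (η (imag (e i - e j))).re := by
      have h3 : ∀ n, cosDefect (ν n) (e j - e i) = cosDefect (ν n) (e i - e j) := fun n => by
        rw [← cosDefect_neg, neg_sub]
      have := tendsto_nhds_unique (hre (e j - e i)) (by simpa only [h3] using hre (e i - e j))
      linarith
    rw [h2, add_comm (e j)]
  -- the representation with the smooth truncation
  have hκ := isLevyMeasure_unweighted ρ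
  have hrep : ∀ u ∈ S, ∃ K : ℝ, (∑ i, ‖u i‖ ≤ K) ∧
      (∀ᵐ ξ ∂(unweighted ρ), (pairing ξ u).re ≤ K) ∧
      η u = 1 / 2 * quadForm A u + pairing (WithLp.toLp 2 fun i => (η (imag (e i))).im) u
        - ((-(η (imag 0)).re : ℝ) : ℂ) + ∫ ξ, taylorRem K u ξ ∂(unweighted ρ) := by
    intro u hu
    obtain ⟨K₀, hK₀⟩ := hsupp u hu
    have hsum0 : 0 ≤ ∑ i, ‖u i‖ := Finset.sum_nonneg fun i _ => norm_nonneg _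
    -- `K ≥ ∑ |u_i|` makes the cut-off inactive for `‖ξ‖ ≤ 1`, so the remainder is of third order
    set K := max K₀ (∑ i, ‖u i‖) with hKdef
    have hK : ∑ i, ‖u i‖ ≤ K := le_max_right _ _
    have hK' : ∀ n, ∀ᵐ ξ ∂(ν n), (pairing ξ u).re ≤ K := fun n =>
      (hK₀ n).mono fun ξ hξ => hξ.trans (le_max_left _ _)
    obtain ⟨g, hg0, hg⟩ := exists_boundedContinuous_taylorRem u hK
    refine ⟨K, hK, (unweighted_absolutelyContinuous ρ).ae_le
      (ae_le_of_weighted_limit hρ (hsum0.trans hK) hK'), ?_⟩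
    refine tendsto_nhds_unique (hlim u hu) ?_
    have hsq : Tendsto (fun n => quadForm (Matrix.of fun i j => ∫ ξ, sinVec ξ i * sinVec ξ j ∂(ν n))
        u) atTop (𝓝 (quadForm A u)) := by
      simp only [quadForm_eq_sum_mul]
      exact tendsto_finsetSum _ fun i _ => tendsto_finsetSum _ fun j _ =>
        ((Complex.continuous_ofReal.tendsto _).comp (hA i j)).mul_const _
    have hln : Tendsto (fun n => pairing (WithLp.toLp 2 fun i => ∫ ξ, sinVec ξ i ∂(ν n)) u) atTop
        (𝓝 (pairing (WithLp.toLp 2 fun i => (η (imag (e i))).im) u)) := by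
      simp only [pairing]
      exact tendsto_finsetSum _ fun i _ =>
        ((Complex.continuous_ofReal.tendsto _).comp (hb i)).mul_const _
    have hrem := hρ g hg0
    rw [← integral_unweighted ρ hg0 hg] at hrem
    simp_rw [integral_weighted, hg] at hrem
    refine ((((hsq.const_mul (1 / 2)).add hln).sub
      ((Complex.continuous_ofReal.tendsto _).comp hc)).add hrem).congr fun n => ?_
    have hbd : ∀ i, Integrable (fun ξ => sinVec ξ i) (ν n) := fun i =>
      Integrable.of_bound (C := 1) (by fun_prop) (ae_of_all _ fun ξ => Real.abs_sin_le_one _)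
    have hbd2 : ∀ i j, Integrable (fun ξ => sinVec ξ i * sinVec ξ j) (ν n) := fun i j =>
      Integrable.of_bound (C := 1) (by fun_prop) (ae_of_all _ fun ξ => by
        simp only [sinVec_apply, norm_mul]
        exact mul_le_one₀ (Real.abs_sin_le_one _) (abs_nonneg _) (Real.abs_sin_le_one _))
    obtain ⟨h4, h4'⟩ := integral_pairing hbd u
    obtain ⟨h5, h5'⟩ := integral_pairing_sq hbd2 u
    obtain ⟨C, hC⟩ := exists_norm_taylorRem_le u hK
    have h3 : Integrable (taylorRem K u) (ν n) :=
      Integrable.of_bound (C := |C|) (continuous_taylorRem K u).aestronglyMeasurable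
        (ae_of_all _ fun ξ => (hC ξ).trans ((mul_le_mul_of_nonneg_right (le_abs_self C)
          (by positivity)).trans (mul_le_of_le_one_right (abs_nonneg C) (min_le_right _ _))))
    have hexp : ∫ ξ, (Complex.exp (pairing ξ u) - 1) ∂(ν n)
        = ∫ ξ, (taylorRem K u ξ + pairing (sinVec ξ) u + pairing (sinVec ξ) u ^ 2 / 2) ∂(ν n) := by
      refine integral_congr_ae ?_
      filter_upwards [hK' n] with ξ hξ
      rw [taylorRem, cutExp_of_le hξ]
      ring
    have h34 : Integrable (fun ξ => taylorRem K u ξ + pairing (sinVec ξ) u) (ν n) := h3.add h4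
    rw [hexp, integral_add h34 (h5.div_const 2), integral_add h3 h4, h4', integral_div, h5']
    simp only [Function.comp_apply]
    ring
  refine ⟨_, _, _, _, ?_, hκ, lk_of_taylorRem hκ A _ _ hrep⟩
  refine hAsymm.sub ?_
  ext i j
  simp only [Matrix.transpose_apply, Matrix.of_apply, mul_comm]

end Existence

/-! ### The vector space of functions of signed Lévy–Khintchine form -/

section Signed

variable {d : ℕ}

namespace SignedLevyMeasure

lemma value_eq_of_add_eq {m m' : SignedLevyMeasure d} (h : m.pos + m'.neg = m'.pos + m.neg)
    {A : Set (E d)} {ε : ℝ} (hε : 0 < ε) (hA : ∀ ξ ∈ A, ε ≤ ‖ξ‖) : m.value A = m'.value A := by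
  have h1 := congrArg (fun κ : Measure (E d) => (κ A).toReal) h
  simp only [Measure.add_apply] at h1
  rw [ENNReal.toReal_add (m.isLevy_pos.measure_lt_top hε hA).ne
    (m'.isLevy_neg.measure_lt_top hε hA).ne, ENNReal.toReal_add
    (m'.isLevy_pos.measure_lt_top hε hA).ne (m.isLevy_neg.measure_lt_top hε hA).ne] at h1
  unfold value
  linarith

/-- A Lévy measure, seen as a signed one. -/
def ofMeasure (κ : Measure (E d)) (hκ : IsLevyMeasure κ) : SignedLevyMeasure d :=
  ⟨κ, 0, hκ, IsLevyMeasure.zero⟩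

/-- The sum of two signed Lévy measures. -/
def add (m m' : SignedLevyMeasure d) : SignedLevyMeasure d :=
  ⟨m.pos + m'.pos, m.neg + m'.neg, m.isLevy_pos.add m'.isLevy_pos, m.isLevy_neg.add m'.isLevy_neg⟩

/-- The multiple of a signed Lévy measure by a real number; the positive and the negative part are
exchanged if the number is negative. -/
def smul (r : ℝ) (m : SignedLevyMeasure d) : SignedLevyMeasure d :=
  ⟨r.toNNReal • m.pos + (-r).toNNReal • m.neg, r.toNNReal • m.neg + (-r).toNNReal • m.pos,
    (m.isLevy_pos.smul _).add (m.isLevy_neg.smul _),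
    (m.isLevy_neg.smul _).add (m.isLevy_pos.smul _)⟩

lemma value_add (m m' : SignedLevyMeasure d) {A : Set (E d)} {ε : ℝ} (hε : 0 < ε)
    (hA : ∀ ξ ∈ A, ε ≤ ‖ξ‖) : (m.add m').value A = m.value A + m'.value A := by
  simp only [value, add, Measure.add_apply]
  rw [ENNReal.toReal_add (m.isLevy_pos.measure_lt_top hε hA).ne
    (m'.isLevy_pos.measure_lt_top hε hA).ne, ENNReal.toReal_add
    (m.isLevy_neg.measure_lt_top hε hA).ne (m'.isLevy_neg.measure_lt_top hε hA).ne]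
  ring

lemma toReal_sub_toReal_neg (r : ℝ) : (r.toNNReal : ℝ) - ((-r).toNNReal : ℝ) = r := by
  rw [Real.coe_toNNReal', Real.coe_toNNReal']
  exact max_zero_sub_max_neg_zero_eq_self r

lemma value_smul (r : ℝ) (m : SignedLevyMeasure d) {A : Set (E d)} {ε : ℝ} (hε : 0 < ε)
    (hA : ∀ ξ ∈ A, ε ≤ ‖ξ‖) : (m.smul r).value A = r * m.value A := by
  have h1 := (m.isLevy_pos.measure_lt_top hε hA).ne
  have h2 := (m.isLevy_neg.measure_lt_top hε hA).ne
  have hr := toReal_sub_toReal_neg r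
  simp only [value, smul, Measure.add_apply, Measure.smul_apply, ENNReal.smul_def, smul_eq_mul]
  rw [ENNReal.toReal_add (by finiteness) (by finiteness),
    ENNReal.toReal_add (by finiteness) (by finiteness)]
  simp only [ENNReal.toReal_mul, ENNReal.coe_toReal]
  linear_combination (((m.pos A).toReal) - (m.neg A).toReal) * hr

lemma Integrable.add {m m' : SignedLevyMeasure d} {g : E d → ℂ} (h : m.Integrable g)
    (h' : m'.Integrable g) :
    (m.add m').Integrable g ∧ (m.add m').integral g = m.integral g + m'.integral g := by
  refine ⟨⟨h.1.add_measure h'.1, h.2.add_measure h'.2⟩, ?_⟩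
  simp only [integral, SignedLevyMeasure.add]
  rw [integral_add_measure h.1 h'.1, integral_add_measure h.2 h'.2]
  ring

lemma Integrable.smul {m : SignedLevyMeasure d} {g : E d → ℂ} (r : ℝ) (h : m.Integrable g) :
    (m.smul r).Integrable g ∧ (m.smul r).integral g = r * m.integral g := by
  have hp : ∀ s : ℝ≥0, MeasureTheory.Integrable g (s • m.pos) := fun s => h.1.smul_measure_nnreal
  have hn : ∀ s : ℝ≥0, MeasureTheory.Integrable g (s • m.neg) := fun s => h.2.smul_measure_nnreal
  refine ⟨⟨(hp _).add_measure (hn _), (hn _).add_measure (hp _)⟩, ?_⟩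
  have hr : ((r.toNNReal : ℝ) : ℂ) - (((-r).toNNReal : ℝ) : ℂ) = r := by
    exact_mod_cast congrArg (fun t : ℝ => (t : ℂ)) (toReal_sub_toReal_neg r)
  simp only [integral, SignedLevyMeasure.smul]
  rw [integral_add_measure (hp _) (hn _), integral_add_measure (hn _) (hp _)]
  simp only [integral_smul_nnreal_measure, NNReal.smul_def, Complex.real_smul]
  linear_combination (∫ ξ, g ξ ∂m.pos - ∫ ξ, g ξ ∂m.neg) * hr

end SignedLevyMeasure

lemma quadForm_add (a b : Matrix (Fin d) (Fin d) ℝ) (u : V d) :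
    quadForm (a + b) u = quadForm a u + quadForm b u := by
  simp [quadForm_eq_sum_mul, add_mul, Finset.sum_add_distrib]

lemma quadForm_smul (r : ℝ) (a : Matrix (Fin d) (Fin d) ℝ) (u : V d) :
    quadForm (r • a) u = r * quadForm a u := by
  simp [quadForm_eq_sum_mul, Finset.mul_sum, mul_assoc]

namespace HasLKForm

variable {S : Set (V d)} {g g' : V d → ℂ} {a a' : Matrix (Fin d) (Fin d) ℝ} {b b' : E d} {c c' : ℝ}
  {m m' : SignedLevyMeasure d}

lemma add (h : HasLKForm S g a b c m) (h' : HasLKForm S g' a' b' c' m') :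
    HasLKForm S (fun u => g u + g' u) (a + a') (b + b') (c + c') (m.add m') := by
  intro u hu
  obtain ⟨hi, hg⟩ := h u hu
  obtain ⟨hi', hg'⟩ := h' u hu
  obtain ⟨h1, h2⟩ := hi.add hi'
  refine ⟨h1, ?_⟩
  beta_reduce
  rw [h2, hg, hg', quadForm_add, pairing_add_left]
  push_cast
  ring

lemma smul (r : ℝ) (h : HasLKForm S g a b c m) :
    HasLKForm S (fun u => r * g u) (r • a) (r • b) (r * c) (m.smul r) := by
  intro u hu
  obtain ⟨hi, hg⟩ := h u hu
  obtain ⟨h1, h2⟩ := hi.smul r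
  refine ⟨h1, ?_⟩
  beta_reduce
  rw [h2, hg, quadForm_smul, pairing_smul_left]
  push_cast
  ring

/-- Affine combinations of functions of Lévy–Khintchine form. -/
lemma add_sum {α : Fin d → Matrix (Fin d) (Fin d) ℝ} {β : Fin d → E d} {γ : Fin d → ℝ}
    {μ : Fin d → SignedLevyMeasure d} {G : Fin d → V d → ℂ} (h : HasLKForm S g a b c m)
    (hG : ∀ i, HasLKForm S (G i) (α i) (β i) (γ i) (μ i)) (x : E d) (s : Finset (Fin d)) :
    ∃ (b' : E d) (m' : SignedLevyMeasure d),
      HasLKForm S (fun u => g u + ∑ i ∈ s, x i * G i u) (a + ∑ i ∈ s, x i • α i) b'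
        (c + ∑ i ∈ s, x i * γ i) m' ∧
      ∀ A : Set (E d), (∃ ε > 0, ∀ ξ ∈ A, ε ≤ ‖ξ‖) →
        m'.value A = m.value A + ∑ i ∈ s, x i * (μ i).value A := by
  induction s using Finset.induction_on with
  | empty => exact ⟨b, m, by simpa using h, by simp⟩
  | insert j s hj ih =>
    obtain ⟨b', m', h1, h2⟩ := ih
    refine ⟨b' + x j • β j, m'.add ((μ j).smul (x j)), ?_, fun A hA => ?_⟩
    · have h3 := h1.add ((hG j).smul (x j))
      have e1 : ∀ u, g u + ∑ i ∈ insert j s, x i * G i u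
          = g u + ∑ i ∈ s, x i * G i u + x j * G j u := fun u => by
        rw [Finset.sum_insert hj]; ring
      have e2 : a + ∑ i ∈ insert j s, x i • α i = a + ∑ i ∈ s, x i • α i + x j • α j := by
        rw [Finset.sum_insert hj, add_assoc, add_comm (x j • α j)]
      have e3 : c + ∑ i ∈ insert j s, x i * γ i = c + ∑ i ∈ s, x i * γ i + x j * γ j := by
        rw [Finset.sum_insert hj]; ring
      simp only [e1, e2, e3]
      exact h3
    · rw [Finset.sum_insert hj]
      obtain ⟨ε, hε, hA'⟩ := hA
      rw [SignedLevyMeasure.value_add _ _ hε hA', SignedLevyMeasure.value_smul _ _ hε hA',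
        h2 A ⟨ε, hε, hA'⟩]
      ring

lemma at_zero (h : HasLKForm S g a b c m) (h0 : (0 : V d) ∈ S) : g 0 = -c := by
  have h1 : (lkIntegrand 0 : E d → ℂ) = fun _ => 0 := by
    ext ξ; simp [lkIntegrand]
  rw [(h 0 h0).2, h1]
  simp [quadForm, SignedLevyMeasure.integral]

end HasLKForm

/-- The functions of signed Lévy–Khintchine form with a symmetric matrix. -/
def lkSubmodule (S : Set (V d)) : Submodule ℝ (V d → ℂ) where
  carrier := {g | ∃ a b c m, a.IsSymm ∧ HasLKForm S g a b c m}
  add_mem' := by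
    rintro g g' ⟨a, b, c, m, hs, h⟩ ⟨a', b', c', m', hs', h'⟩
    exact ⟨_, _, _, _, hs.add hs', h.add h'⟩
  zero_mem' := by
    refine ⟨0, 0, 0, .ofMeasure 0 IsLevyMeasure.zero, Matrix.isSymm_zero, fun u _ => ⟨⟨?_, ?_⟩, ?_⟩⟩
    · exact integrable_zero_measure
    · exact integrable_zero_measure
    · simp [quadForm, SignedLevyMeasure.integral, SignedLevyMeasure.ofMeasure]
  smul_mem' := by
    rintro r g ⟨a, b, c, m, hs, h⟩
    exact ⟨_, _, _, _, hs.smul r, by simpa [Pi.smul_def] using h.smul r⟩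

lemma hasLKForm_ofMeasure {S : Set (V d)} {η : V d → ℂ} {a : Matrix (Fin d) (Fin d) ℝ} {b : E d}
    {c : ℝ} {κ : Measure (E d)} (hκ : IsLevyMeasure κ)
    (h : ∀ u ∈ S, Integrable (lkIntegrand u) κ ∧
      η u = 1 / 2 * quadForm a u + pairing b u - c + ∫ ξ, lkIntegrand u ξ ∂κ) :
    HasLKForm S η a b c (.ofMeasure κ hκ) := fun u hu =>
  ⟨⟨(h u hu).1, integrable_zero_measure⟩, by
    rw [(h u hu).2]; simp [SignedLevyMeasure.integral, SignedLevyMeasure.ofMeasure]⟩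

/-! ### The diffusion matrix and the jump measure are determined by the exponent -/

lemma quadForm_imag (a : Matrix (Fin d) (Fin d) ℝ) (y : E d) :
    quadForm a (imag y) = -((∑ i, ∑ j, y i * a i j * y j : ℝ) : ℂ) := by
  simp only [quadForm, imag_apply]
  push_cast
  rw [← Finset.sum_neg_distrib]
  refine Finset.sum_congr rfl fun i _ => ?_
  rw [← Finset.sum_neg_distrib]
  refine Finset.sum_congr rfl fun j _ => ?_
  linear_combination (y i : ℂ) * a i j * y j * Complex.I_mul_I

lemma IsLevyMeasure.integrable_lkIntegrand_imag {κ : Measure (E d)} (hκ : IsLevyMeasure κ)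
    (y : E d) : Integrable (lkIntegrand (imag y)) κ :=
  hκ.integrable_of_le (measurable_lkIntegrand _) (ae_of_all _ (norm_lkIntegrand_imag_le y))

/-- The jump part of an exponent grows slower than quadratically in imaginary directions. -/
lemma IsLevyMeasure.tendsto_integral_lkIntegrand {κ : Measure (E d)} (hκ : IsLevyMeasure κ)
    (y : E d) : Tendsto (fun n : ℕ => (∫ ξ, lkIntegrand (imag ((n : ℝ) • y)) ξ ∂κ) / (n : ℂ) ^ 2)
      atTop (𝓝 0) := by
  simp_rw [← integral_div]
  rw [← integral_zero (E d) ℂ (μ := κ)]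
  refine tendsto_integral_of_dominated_convergence
    (fun ξ => (3 * ‖y‖ ^ 2 + 2) * min (‖ξ‖ ^ 2) 1)
    (fun n => ((measurable_lkIntegrand _).div_const _).aestronglyMeasurable)
    (hκ.integrable_min.const_mul _) (fun n => ae_of_all _ fun ξ => ?_) (ae_of_all _ fun ξ => ?_)
  · rcases n.eq_zero_or_pos with rfl | hn
    · simp only [CharP.cast_eq_zero, ne_eq, OfNat.ofNat_ne_zero, not_false_eq_true, zero_pow,
        div_zero, norm_zero]
      positivity
    · have hn1 : (1 : ℝ) ≤ n := by exact_mod_cast hn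
      rw [norm_div, norm_pow, Complex.norm_natCast, div_le_iff₀ (by positivity)]
      refine (norm_lkIntegrand_imag_le _ ξ).trans ?_
      rw [norm_smul, Real.norm_natCast]
      have h1 : 3 * (n * ‖y‖) ^ 2 + 2 ≤ (3 * ‖y‖ ^ 2 + 2) * n ^ 2 := by nlinarith
      have := mul_le_mul_of_nonneg_right h1 (min_sq_one_nonneg ξ)
      linarith
  · have hb : ∀ n : ℕ, ‖lkIntegrand (imag ((n : ℝ) • y)) ξ / (n : ℂ) ^ 2‖
        ≤ 2 / (n : ℝ) ^ 2 + ‖trunc ξ‖ * ‖y‖ / n := by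
      intro n
      rcases n.eq_zero_or_pos with rfl | hn
      · simp
      have hn0 : (0 : ℝ) < n := by exact_mod_cast hn
      have h1 : ‖lkIntegrand (imag ((n : ℝ) • y)) ξ‖ ≤ 2 + n * (‖trunc ξ‖ * ‖y‖) := by
        rw [lkIntegrand, pairing_imag, pairing_imag]
        refine (norm_sub_le _ _).trans (add_le_add ((norm_sub_le _ _).trans ?_) ?_)
        · rw [Complex.norm_exp_ofReal_mul_I, norm_one]; norm_num
        · rw [norm_mul, Complex.norm_I, mul_one, Complex.norm_real, real_inner_smul_right, norm_mul,
            Real.norm_natCast]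
          gcongr
          exact norm_inner_le_norm _ _
      rw [norm_div, norm_pow, Complex.norm_natCast, div_le_iff₀ (by positivity)]
      refine h1.trans (le_of_eq ?_)
      field_simp
    refine squeeze_zero_norm hb ?_
    have h1 : Tendsto (fun n : ℕ => 2 / (n : ℝ) ^ 2) atTop (𝓝 0) :=
      tendsto_const_nhds.div_atTop
        ((tendsto_pow_atTop two_ne_zero).comp tendsto_natCast_atTop_atTop)
    simpa using h1.add (tendsto_const_div_atTop_nhds_zero_nat (‖trunc ξ‖ * ‖y‖))

namespace HasLKForm

variable {S : Set (V d)} {g : V d → ℂ} {a a' : Matrix (Fin d) (Fin d) ℝ} {b b' : E d} {c c' : ℝ}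
  {m m' : SignedLevyMeasure d}

/-- The quadratic part of an exponent is its leading term in imaginary directions. -/
lemma tendsto_div_sq (h : HasLKForm S g a b c m) (hS : ∀ y, imag y ∈ S) (y : E d) :
    Tendsto (fun n : ℕ => g (imag ((n : ℝ) • y)) / (n : ℂ) ^ 2) atTop
      (𝓝 (1 / 2 * quadForm a (imag y))) := by
  have h1 := (m.isLevy_pos.tendsto_integral_lkIntegrand y).sub
    (m.isLevy_neg.tendsto_integral_lkIntegrand y)
  have h2 : Tendsto (fun n : ℕ => pairing b (imag y) / (n : ℂ)) atTop (𝓝 0) :=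
    tendsto_const_div_atTop_nhds_zero_nat _
  have h3 : Tendsto (fun n : ℕ => (c : ℂ) / (n : ℂ) / (n : ℂ)) atTop (𝓝 0) := by
    have h4 : Tendsto (fun n : ℕ => (c : ℂ) / (n : ℂ)) atTop (𝓝 0) :=
      tendsto_const_div_atTop_nhds_zero_nat _
    have h5 : Tendsto (fun n : ℕ => (1 : ℂ) / (n : ℂ)) atTop (𝓝 0) :=
      tendsto_const_div_atTop_nhds_zero_nat _
    simpa [div_eq_mul_inv] using h4.mul h5
  have h6 := (((tendsto_const_nhds (x := 1 / 2 * quadForm a (imag y))).add h2).sub h3).add h1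
  simp only [add_zero, sub_zero] at h6
  refine h6.congr' ?_
  filter_upwards [eventually_gt_atTop 0] with n hn
  have hn0 : (n : ℂ) ≠ 0 := by exact_mod_cast hn.ne'
  rw [(h _ (hS _)).2, SignedLevyMeasure.integral]
  have hq : quadForm a (imag ((n : ℝ) • y)) = (n : ℂ) ^ 2 * quadForm a (imag y) := by
    simp only [quadForm_eq_sum_mul, imag_apply, Finset.mul_sum, PiLp.smul_apply, smul_eq_mul]
    refine Finset.sum_congr rfl fun i _ => Finset.sum_congr rfl fun j _ => ?_
    push_cast
    ring
  have hp : pairing b (imag ((n : ℝ) • y)) = (n : ℂ) * pairing b (imag y) := by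
    rw [imag_smul, pairing_smul_right]
    simp
  rw [hq, hp]
  field_simp

lemma quadForm_imag_eq (h : HasLKForm S g a b c m) (h' : HasLKForm S g a' b' c' m')
    (hS : ∀ y, imag y ∈ S) (y : E d) : quadForm a (imag y) = quadForm a' (imag y) := by
  have := tendsto_nhds_unique (h.tendsto_div_sq hS y) (h'.tendsto_div_sq hS y)
  linear_combination 2 * this

/-- The matrix is positive semidefinite because the leading term of the exponent in imaginary
directions has non-positive real part. -/
lemma posSemidef (h : HasLKForm S g a b c m) (hS : ∀ y, imag y ∈ S) (ha : a.IsSymm)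
    (hg : ∀ y, (g (imag y)).re ≤ 0) : a.PosSemidef := by
  refine Matrix.PosSemidef.of_dotProduct_mulVec_nonneg ?_ fun v => ?_
  · rw [Matrix.IsHermitian, Matrix.conjTranspose_eq_transpose_of_trivial]; exact ha
  have h1 := (Complex.continuous_re.tendsto _).comp (h.tendsto_div_sq hS (WithLp.toLp 2 v))
  have h2 := le_of_tendsto' h1 (b := 0) fun n => by
    have : ((n : ℂ) ^ 2) = (((n : ℝ) ^ 2 : ℝ) : ℂ) := by push_cast; rfl
    rw [Function.comp_apply, this, Complex.div_ofReal_re]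
    exact div_nonpos_of_nonpos_of_nonneg (hg _) (sq_nonneg _)
  rw [quadForm_imag, ← Complex.ofReal_neg] at h2
  have h3 : ((1 / 2 : ℂ) * ((-(∑ i, ∑ j, v i * a i j * v j) : ℝ) : ℂ)).re
      = -(∑ i, ∑ j, v i * a i j * v j) / 2 := by
    simp
    ring
  have h4 : star v ⬝ᵥ a.mulVec v = ∑ i, ∑ j, v i * a i j * v j := by
    simp [dotProduct, Matrix.mulVec, Finset.mul_sum, mul_assoc]
  rw [h4]
  have h5 := h3.symm.trans_le h2
  linarith

lemma lkIntegrand_secondDiff (ξ y z : E d) :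
    lkIntegrand (imag y) ξ - lkIntegrand (imag (y + z)) ξ / 2 - lkIntegrand (imag (y - z)) ξ / 2
      = Complex.exp ((inner ℝ ξ y : ℝ) * Complex.I) * ((1 - Real.cos (inner ℝ ξ z) : ℝ) : ℂ) := by
  rw [← exp_secondDiff]
  simp only [lkIntegrand, secondDiff, pairing_imag, inner_add_right, inner_sub_right]
  push_cast
  ring

end HasLKForm

lemma IsLevyMeasure.integral_secondDiff {κ : Measure (E d)} (hκ : IsLevyMeasure κ) (y z : E d) :
    ∫ ξ, Complex.exp ((inner ℝ ξ y : ℝ) * Complex.I) * ((1 - Real.cos (inner ℝ ξ z) : ℝ) : ℂ) ∂κ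
      = ∫ ξ, lkIntegrand (imag y) ξ ∂κ - (∫ ξ, lkIntegrand (imag (y + z)) ξ ∂κ) / 2
        - (∫ ξ, lkIntegrand (imag (y - z)) ξ ∂κ) / 2 := by
  have hi := hκ.integrable_lkIntegrand_imag
  simp_rw [← HasLKForm.lkIntegrand_secondDiff]
  have h1 : Integrable (fun ξ => lkIntegrand (imag y) ξ - lkIntegrand (imag (y + z)) ξ / 2) κ :=
    (hi y).sub ((hi _).div_const 2)
  rw [integral_sub h1 ((hi _).div_const 2), integral_sub (hi y) ((hi _).div_const 2),
    integral_div, integral_div]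

lemma IsLevyMeasure.integrable_one_sub_cos {κ : Measure (E d)} (hκ : IsLevyMeasure κ) (z : E d) :
    Integrable (fun ξ : E d => 1 - Real.cos (inner ℝ ξ z)) κ := by
  refine (hκ.integrable_min.const_mul (‖z‖ ^ 2 + 2)).mono' (by fun_prop) (ae_of_all _ fun ξ => ?_)
  have h1 := Real.one_sub_sq_div_two_le_cos (x := inner ℝ ξ z)
  have h2 := Real.neg_one_le_cos (inner ℝ ξ z)
  rw [Real.norm_of_nonneg (sub_nonneg.2 (Real.cos_le_one _))]
  rcases le_total (‖ξ‖ ^ 2) 1 with h | h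
  · rw [min_eq_left h]
    have h3 := abs_real_inner_le_norm ξ z
    have h4 : (inner ℝ ξ z) ^ 2 ≤ (‖ξ‖ * ‖z‖) ^ 2 := sq_le_sq' (abs_le.1 h3).1 (abs_le.1 h3).2
    nlinarith [sq_nonneg ‖ξ‖, sq_nonneg (‖ξ‖ * ‖z‖)]
  · rw [min_eq_right h]
    nlinarith [sq_nonneg ‖z‖]

/-- A Lévy measure `κ` is determined by the characteristic functions of the finite measures
`(1 - cos⟨ξ, z⟩) κ(dξ)`: countably many of the sets `{ξ | cos⟨ξ, z⟩ ≠ 1}` cover `ℝ^d \ {0}`. -/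
lemma IsLevyMeasure.ext_of_integral {κ κ' : Measure (E d)} (hκ : IsLevyMeasure κ)
    (hκ' : IsLevyMeasure κ')
    (h : ∀ y z : E d,
      ∫ ξ, Complex.exp ((inner ℝ ξ y : ℝ) * Complex.I) * ((1 - Real.cos (inner ℝ ξ z) : ℝ) : ℂ) ∂κ
        = ∫ ξ, Complex.exp ((inner ℝ ξ y : ℝ) * Complex.I)
            * ((1 - Real.cos (inner ℝ ξ z) : ℝ) : ℂ) ∂κ') : κ = κ' := by
  have hnn : ∀ ξ z : E d, 0 ≤ 1 - Real.cos (inner ℝ ξ z) := fun ξ z =>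
    sub_nonneg.2 (Real.cos_le_one _)
  let f : E d → E d → ℝ≥0∞ := fun z ξ => ENNReal.ofReal (1 - Real.cos (inner ℝ ξ z))
  have hfm : ∀ z, Measurable (f z) := fun z => by fun_prop
  have hchar : ∀ {κ : Measure (E d)} (y z : E d), charFun (κ.withDensity (f z)) y
      = ∫ ξ, Complex.exp ((inner ℝ ξ y : ℝ) * Complex.I)
        * ((1 - Real.cos (inner ℝ ξ z) : ℝ) : ℂ) ∂κ := fun {κ} y z => by
    rw [charFun_apply, integral_withDensity_eq_integral_toReal_smul (hfm z)
      (ae_of_all _ fun _ => ENNReal.ofReal_lt_top)]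
    refine integral_congr_ae (ae_of_all _ fun ξ => ?_)
    simp only [f, ENNReal.toReal_ofReal (hnn ξ z), Complex.real_smul, mul_comm]
  have hdens : ∀ z, κ.withDensity (f z) = κ'.withDensity (f z) := fun z => by
    have := isFiniteMeasure_withDensity_ofReal (hκ.integrable_one_sub_cos z).2
    have := isFiniteMeasure_withDensity_ofReal (hκ'.integrable_one_sub_cos z).2
    refine Measure.ext_of_charFun (funext fun y => ?_)
    rw [hchar, hchar, h]
  have hB : ∀ z, MeasurableSet {ξ | f z ξ ≠ 0} := fun z =>
    (measurableSet_eq_fun (hfm z) measurable_const).compl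
  -- on the set where the density `f z` does not vanish it can be divided out
  have hinv : ∀ (κ : Measure (E d)) z, κ.restrict {ξ | f z ξ ≠ 0}
      = ((κ.withDensity (f z)).restrict {ξ | f z ξ ≠ 0}).withDensity fun ξ => (f z ξ)⁻¹ := fun κ z => by
    rw [restrict_withDensity (hB z), withDensity_inv_same (hfm z)]
    · exact ae_restrict_mem (hB z)
    · exact ae_of_all _ fun _ => ENNReal.ofReal_ne_top
  have hrestrict : ∀ z, κ.restrict {ξ | f z ξ ≠ 0} = κ'.restrict {ξ | f z ξ ≠ 0} := fun z => by
    rw [hinv κ, hinv κ', hdens]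
  let e : Fin d × ℕ → E d := fun p => EuclideanSpace.single p.1 ((p.2 + 1 : ℝ)⁻¹)
  let B : Option (Fin d × ℕ) → Set (E d) := fun o => o.elim {0} fun p => {ξ | f (e p) ξ ≠ 0}
  refine Measure.ext_of_iUnion_eq_univ (s := B) ?_ ?_
  · refine eq_univ_of_forall fun ξ => mem_iUnion.2 ?_
    rcases eq_or_ne ξ 0 with rfl | hξ
    · exact ⟨none, rfl⟩
    obtain ⟨i, hi⟩ : ∃ i, ξ i ≠ 0 := by
      by_contra! h0
      exact hξ (by ext i; simpa using h0 i)
    obtain ⟨k, hk⟩ := exists_nat_gt |ξ i|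
    refine ⟨some (i, k), ?_⟩
    -- the angle `ξ_i / (k + 1)` is non-zero and less than `1` in absolute value
    have hk1 : (0 : ℝ) < k + 1 := by positivity
    have hin : inner ℝ ξ (e (i, k)) = (k + 1 : ℝ)⁻¹ * ξ i := by
      simp [e, EuclideanSpace.inner_single_right]
    have hlt : |(k + 1 : ℝ)⁻¹ * ξ i| < 1 := by
      rw [abs_mul, abs_of_pos (inv_pos.2 hk1), inv_mul_lt_iff₀ hk1]
      linarith
    have hne : (k + 1 : ℝ)⁻¹ * ξ i ≠ 0 := mul_ne_zero (inv_ne_zero hk1.ne') hi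
    change f (e (i, k)) ξ ≠ 0
    simp only [f, hin]
    rw [ne_eq, ENNReal.ofReal_eq_zero, not_le, sub_pos]
    have hpi := Real.pi_gt_three
    refine lt_of_le_of_ne (Real.cos_le_one _) fun hcos => hne ?_
    exact (Real.cos_eq_one_iff_of_lt_of_lt (by linarith [(abs_lt.1 hlt).1])
      (by linarith [(abs_lt.1 hlt).2])).1 hcos
  · rintro (_ | p)
    · change κ.restrict {0} = κ'.restrict {0}
      rw [Measure.restrict_eq_zero.2 hκ.1, Measure.restrict_eq_zero.2 hκ'.1]
    · exact hrestrict (e p)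

/-- The signed Lévy measure in a Lévy–Khintchine representation is unique. -/
lemma HasLKForm.pos_add_neg_eq {S : Set (V d)} {g : V d → ℂ} {a a' : Matrix (Fin d) (Fin d) ℝ}
    {b b' : E d} {c c' : ℝ} {m m' : SignedLevyMeasure d} (h : HasLKForm S g a b c m)
    (h' : HasLKForm S g a' b' c' m') (hS : ∀ y, imag y ∈ S) :
    m.pos + m'.neg = m'.pos + m.neg := by
  refine (m.isLevy_pos.add m'.isLevy_neg).ext_of_integral (m'.isLevy_pos.add m.isLevy_neg)
    fun y z => ?_
  have hz := h.quadForm_imag_eq h' hS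
  -- the quadratic parts agree, the linear and constant parts have vanishing second differences
  have key : ∀ y, m.integral (lkIntegrand (imag y)) - m'.integral (lkIntegrand (imag y))
      = pairing (b' - b) (imag y) - (c' - c) := fun y => by
    have h1 := (h _ (hS y)).2
    have h2 := (h' _ (hS y)).2
    rw [pairing_sub_left]
    linear_combination h2 - h1 - (1 / 2) * hz y
  have hadd : ∀ {κ κ' : Measure (E d)}, IsLevyMeasure κ → IsLevyMeasure κ' → ∀ y,
      ∫ ξ, lkIntegrand (imag y) ξ ∂(κ + κ')
        = ∫ ξ, lkIntegrand (imag y) ξ ∂κ + ∫ ξ, lkIntegrand (imag y) ξ ∂κ' := fun hκ hκ' y =>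
    integral_add_measure (hκ.integrable_lkIntegrand_imag y) (hκ'.integrable_lkIntegrand_imag y)
  have hlin : pairing (b' - b) (imag y) - pairing (b' - b) (imag (y + z)) / 2
      - pairing (b' - b) (imag (y - z)) / 2 = 0 := by
    simp only [pairing_imag, inner_add_right, inner_sub_right]
    push_cast
    ring
  rw [(m.isLevy_pos.add m'.isLevy_neg).integral_secondDiff,
    (m'.isLevy_pos.add m.isLevy_neg).integral_secondDiff]
  simp only [hadd m.isLevy_pos m'.isLevy_neg, hadd m'.isLevy_pos m.isLevy_neg]
  simp only [SignedLevyMeasure.integral] at key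
  linear_combination key y - key (y + z) / 2 - key (y - z) / 2 + hlin

end Signed

/-! ### The exponents `F(u) + ⟨x, R(u)⟩` as limits -/

section Generator

variable {d : ℕ} {D : Set (E d)} {Ω : Type*} [MeasurableSpace Ω] {M : MarkovProcess D Ω}
  {Φ φ : ℝ → V d → ℂ} {ψ : ℝ → V d → V d}

lemma measurableSet_range_coe : MeasurableSet (range ((↑) : D → OnePoint D)) := by
  rw [measurableSet_onePoint, preimage_range]
  exact MeasurableSet.univ

/-- The increment `ξ - x` of the position, set to `0` at the cemetery state. -/
def increment (x : D) : OnePoint D → E d := extendZero fun ξ : D => (ξ : E d) - x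

lemma measurable_increment (x : D) : Measurable (increment x) :=
  measurable_extendZero (by fun_prop)

variable (M) in
/-- The law of the increment `X_t - x` under `ℙ^x`, on the event that `X_t` is not in the cemetery
state; a measure of mass at most one. -/
def incrementLaw (t : ℝ≥0) (x : D) : Measure (E d) :=
  ((M.kernel t x).restrict (range ((↑) : D → OnePoint D))).map (increment x)

instance (t : ℝ≥0) (x : D) : IsFiniteMeasure (incrementLaw M t x) := by
  unfold incrementLaw; infer_instance

lemma incrementLaw_real_univ_le (t : ℝ≥0) (x : D) : (incrementLaw M t x).real univ ≤ 1 := by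
  rw [measureReal_def, incrementLaw, Measure.map_apply (measurable_increment x) .univ, preimage_univ,
    Measure.restrict_apply_univ]
  exact ENNReal.toReal_le_of_le_ofReal zero_le_one (by simpa using prob_le_one)

lemma ae_incrementLaw_le {k : ℕ} {u : V d} (hu : u ∈ Uk D k) (t : ℝ≥0) (x : D) :
    ∀ᵐ ξ ∂(incrementLaw M t x), (pairing ξ u).re ≤ k - (pairing x u).re := by
  have hm : MeasurableSet {ξ : E d | (pairing ξ u).re ≤ k - (pairing x u).re} :=
    measurableSet_le (Complex.measurable_re.comp (measurable_pairing_left u)) measurable_const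
  rw [incrementLaw, ae_map_iff (measurable_increment x).aemeasurable hm,
    ae_restrict_iff' measurableSet_range_coe]
  refine ae_of_all _ ?_
  rintro _ ⟨ξ, rfl⟩
  change (pairing ((ξ : E d) - (x : E d)) u).re ≤ _
  rw [pairing_sub_left, Complex.sub_re]
  linarith [hu ξ ξ.2]

lemma integral_exp_incrementLaw (haff : IsAffine M Φ ψ) {u : V d} (hu : u ∈ U D) (t : ℝ≥0)
    (x : D) : ∫ ξ, Complex.exp (pairing ξ u) ∂(incrementLaw M t x)
      = Φ t u * Complex.exp (pairing x (ψ t u) - pairing x u) := by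
  have hm := measurable_pairing_left u
  rw [incrementLaw, integral_map (measurable_increment x).aemeasurable (by fun_prop)]
  have h1 : ∀ y ∈ range ((↑) : D → OnePoint D), Complex.exp (pairing (increment x y) u)
      = extendZero (expD D u) y * Complex.exp (-pairing x u) := by
    rintro _ ⟨ξ, rfl⟩
    change Complex.exp (pairing ((ξ : E d) - (x : E d)) u) = Complex.exp (pairing ξ u) * _
    rw [pairing_sub_left, sub_eq_add_neg, Complex.exp_add]
  rw [setIntegral_congr_fun measurableSet_range_coe h1,
    setIntegral_eq_integral_of_forall_compl_eq_zero, integral_mul_const, haff.integral_eq t x hu,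
    mul_assoc, ← Complex.exp_add, sub_eq_add_neg]
  intro y hy
  induction y using OnePoint.rec with
  | infty => simp
  | coe ξ => exact absurd (mem_range_self ξ) hy

lemma integrable_exp_incrementLaw {u : V d} (hu : u ∈ U D) (t : ℝ≥0) (x : D) :
    Integrable (fun ξ => Complex.exp (pairing ξ u)) (incrementLaw M t x) := by
  obtain ⟨k, hk⟩ := mem_U_iff.1 hu
  have hm := measurable_pairing_left u
  refine Integrable.of_bound (by fun_prop) (Real.exp (k - (pairing x u).re)) ?_
  filter_upwards [ae_incrementLaw_le (M := M) hk t x] with ξ hξ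
  rw [Complex.norm_exp]
  gcongr

/-- The small times `1 / (n + 1)`. -/
def smallTime (n : ℕ) : ℝ≥0 := (n + 1 : ℝ≥0)⁻¹

lemma tendsto_smallTime : Tendsto (fun n => (smallTime n : ℝ)) atTop (𝓝[>] 0) := by
  refine tendsto_nhdsWithin_iff.2 ⟨?_, Eventually.of_forall fun n => ?_⟩
  · simpa [smallTime, one_div] using tendsto_one_div_add_atTop_nhds_zero_nat (𝕜 := ℝ)
  · simp only [smallTime, mem_Ioi]
    positivity

variable {F : V d → ℂ} {R : V d → V d}

/-- The derivative of `t ↦ E^x[e^{⟨X_t - x, u⟩}]` at `t = 0` is `F(u) + ⟨x, R(u)⟩`. -/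
lemma tendsto_difference_quotient (hne : D.Nonempty) (hspan : affineSpan ℝ D = ⊤)
    (haff : IsAffine M Φ ψ) (hdist : IsDistinguished D Φ φ ψ) (hreg : IsRegular D φ ψ F R) (x : D)
    {u : V d} (hu : u ∈ U D) :
    Tendsto (fun n : ℕ => ((n : ℂ) + 1)
      * (∫ ξ, Complex.exp (pairing ξ u) ∂(incrementLaw M (smallTime n) x) - 1)) atTop
      (𝓝 (F u + pairing x (R u))) := by
  obtain ⟨hφ0, hψ0⟩ := initial_values hne hspan haff hdist hu
  have hpair : HasDerivWithinAt (fun t => pairing x (ψ t u)) (pairing x (R u)) (Ici 0) 0 := by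
    simp only [pairing]
    refine HasDerivWithinAt.fun_sum fun i _ => HasDerivWithinAt.const_mul _ ?_
    exact ((EuclideanSpace.proj (𝕜 := ℂ) i).restrictScalars ℝ).hasFDerivAt.comp_hasDerivWithinAt 0
      (hreg.deriv_psi u hu)
  have hd := (((hreg.deriv_phi u hu).add hpair).sub_const (pairing x u)).cexp
  simp only [Pi.add_apply, hφ0, hψ0, zero_add, sub_self, Complex.exp_zero, one_mul] at hd
  rw [hasDerivWithinAt_iff_tendsto_slope, Ici_sdiff_left] at hd
  refine (hd.comp tendsto_smallTime).congr' ?_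
  obtain ⟨T, hT0, hT⟩ := IsAffine.exists_gt_lt_sigma le_rfl
    (by simpa using haff.sigma_pos hne hu : ENNReal.ofReal 0 < sigma Φ u)
  have hlt : ∀ᶠ n in atTop, (smallTime n : ℝ) < T :=
    (tendsto_smallTime.mono_right nhdsWithin_le_nhds).eventually (gt_mem_nhds hT0)
  filter_upwards [hlt] with n hn
  rw [integral_exp_incrementLaw haff hu, Phi_eq_exp hdist hu (NNReal.coe_nonneg (smallTime n))
    ((ENNReal.ofReal_le_ofReal hn.le).trans_lt hT), ← Complex.exp_add, Function.comp_apply,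
    slope_def_module]
  simp [hφ0, hψ0, smallTime, add_sub_assoc]

lemma norm_integral_exp_imag_le (t : ℝ≥0) (x : D) (y : E d) :
    ‖∫ ξ, Complex.exp (pairing ξ (imag y)) ∂(incrementLaw M t x)‖ ≤ 1 := by
  refine (norm_integral_le_of_norm_le_const (C := 1) (ae_of_all _ fun ξ => ?_)).trans ?_
  · rw [pairing_imag, Complex.norm_exp_ofReal_mul_I]
  · rw [one_mul]; exact incrementLaw_real_univ_le t x

/-- The exponent `F(u) + ⟨x, R(u)⟩` has non-positive real part in imaginary directions. -/
lemma re_exponent_nonpos (hne : D.Nonempty) (hspan : affineSpan ℝ D = ⊤)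
    (haff : IsAffine M Φ ψ) (hdist : IsDistinguished D Φ φ ψ) (hreg : IsRegular D φ ψ F R) (x : D)
    (y : E d) : (F (imag y) + pairing x (R (imag y))).re ≤ 0 := by
  have h := (Complex.continuous_re.tendsto _).comp
    (tendsto_difference_quotient hne hspan haff hdist hreg x (imag_mem_U y))
  refine le_of_tendsto' h fun n => ?_
  have h1 := (Complex.re_le_norm _).trans (norm_integral_exp_imag_le (M := M) (smallTime n) x y)
  have h2 : ((n : ℂ) + 1) = ((n + 1 : ℝ) : ℂ) := by push_cast; rfl
  rw [Function.comp_apply, h2, Complex.re_ofReal_mul, Complex.sub_re, Complex.one_re]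
  exact mul_nonpos_of_nonneg_of_nonpos (by positivity) (by linarith)

/-- For `x ∈ D` the exponent `F(u) + ⟨x, R(u)⟩` is of Lévy–Khintchine form. -/
lemma exists_levyKhintchine_exponent (hne : D.Nonempty) (hspan : affineSpan ℝ D = ⊤)
    (haff : IsAffine M Φ ψ) (hdist : IsDistinguished D Φ φ ψ) (hreg : IsRegular D φ ψ F R) (x : D) :
    ∃ (a : Matrix (Fin d) (Fin d) ℝ) (b : E d) (c : ℝ) (κ : Measure (E d)) (hκ : IsLevyMeasure κ),
      a.IsSymm ∧
        HasLKForm (U D) (fun u => F u + pairing x (R u)) a b c (.ofMeasure κ hκ) := by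
  have hmaps : MapsTo imag (univ : Set (E d)) (Uk D 0) := fun y _ => imag_mem_Uk 0 y
  have hcont : Continuous fun y => F (imag y) + pairing x (R (imag y)) := by
    have hF := (hreg.continuousOn_F 0).comp continuous_imag.continuousOn hmaps
    have hR := (hreg.continuousOn_R 0).comp continuous_imag.continuousOn hmaps
    exact (continuousOn_univ.1 hF).add
      ((continuous_pairing_right (x : E d)).comp (continuousOn_univ.1 hR))
  let ν : ℕ → Measure (E d) := fun n => (n + 1 : ℝ≥0) • incrementLaw M (smallTime n) x
  have hsupp : ∀ u ∈ U D, ∃ K : ℝ, ∀ n, ∀ᵐ ξ ∂(ν n), (pairing ξ u).re ≤ K := fun u hu => by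
    obtain ⟨k, hk⟩ := mem_U_iff.1 hu
    exact ⟨_, fun n => Measure.ae_smul_measure (ae_incrementLaw_le (M := M) hk (smallTime n) x) _⟩
  obtain ⟨a, b, c, κ, ha, hκ, h⟩ := exists_levyKhintchine (S := U D) imag_mem_U hsupp
    (c := fun n => (n + 1) * (1 - (incrementLaw M (smallTime n) x).real univ))
    (η := fun u => F u + pairing x (R u)) hcont fun u hu => by
      refine (tendsto_difference_quotient hne hspan haff hdist hreg x hu).congr fun n => ?_
      rw [integral_smul_nnreal_measure,
        integral_sub (integrable_exp_incrementLaw hu _ x) (integrable_const _), NNReal.smul_def,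
        Complex.real_smul]
      simp
      ring
  exact ⟨a, b, c, κ, hκ, ha, hasLKForm_ofMeasure hκ h⟩

lemma pairing_eq_sum (x : E d) (v : V d) : pairing x v = ∑ i, x i * v i := rfl

/-- As `D` spans `ℝ^d` affinely, `F` and the components of `R` are linear combinations of the
exponents `F + ⟨x, R⟩`, `x ∈ D`. -/
lemma mem_lkSubmodule (hne : D.Nonempty) (hspan : affineSpan ℝ D = ⊤) {S : Set (V d)}
    (h : ∀ x ∈ D, (fun u => F u + pairing x (R u)) ∈ lkSubmodule S) :
    F ∈ lkSubmodule S ∧ ∀ i, (fun u => R u i) ∈ lkSubmodule S := by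
  let L : E d →ₗ[ℝ] (V d → ℂ) :=
    { toFun := fun w u => pairing w (R u)
      map_add' := fun v w => funext fun u => pairing_add_left v w _
      map_smul' := fun r w => funext fun u => by simp [pairing_smul_left] }
  have htop : (lkSubmodule S).comap L = ⊤ := eq_top_of_sub_mem hspan _ fun x hx y hy => by
    have := (lkSubmodule S).sub_mem (h x hx) (h y hy)
    refine Submodule.mem_comap.2 ?_
    convert this using 1
    ext u
    simp [L, pairing_sub_left]
  have hL : ∀ w, L w ∈ lkSubmodule S := fun w =>
    Submodule.mem_comap.1 (htop ▸ Submodule.mem_top : w ∈ (lkSubmodule S).comap L)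
  constructor
  · obtain ⟨x, hx⟩ := hne
    have := (lkSubmodule S).sub_mem (h x hx) (hL x)
    convert this using 1
    ext u
    simp [L]
  · intro i
    have := hL (EuclideanSpace.single i 1)
    convert this using 1
    ext u
    simp [L, pairing_single]

end Generator

end AffineProc

end

theorem mainTheorem2 {d : ℕ} (D : Set (AffineProc.E d)) (hD_ne : D.Nonempty)
    (hD_meas : MeasurableSet D) (hD_span : affineSpan ℝ D = ⊤)
    {Ω : Type*} [MeasurableSpace Ω] (M : AffineProc.MarkovProcess D Ω)
    (Φ φ : ℝ → AffineProc.V d → ℂ) (ψ : ℝ → AffineProc.V d → AffineProc.V d)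
    (haff : AffineProc.IsAffine M Φ ψ) (hdist : AffineProc.IsDistinguished D Φ φ ψ)
    (F : AffineProc.V d → ℂ) (R : AffineProc.V d → AffineProc.V d)
    (hreg : AffineProc.IsRegular D φ ψ F R) :
    (∃ (a : Matrix (Fin d) (Fin d) ℝ) (α : Fin d → Matrix (Fin d) (Fin d) ℝ)
        (b : AffineProc.E d) (β : Fin d → AffineProc.E d) (c : ℝ) (γ : Fin d → ℝ)
        (m : AffineProc.SignedLevyMeasure d) (μ : Fin d → AffineProc.SignedLevyMeasure d),
      AffineProc.HasLKForm (AffineProc.U D) F a b c m ∧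
      (∀ i, AffineProc.HasLKForm (AffineProc.U D) (fun u => R u i) (α i) (β i) (γ i) (μ i)) ∧
      ∀ x ∈ D,
        (a + ∑ i, x i • α i).PosSemidef ∧
        0 ≤ c + ∑ i, x i * γ i ∧
        ∃ ν : Measure (AffineProc.E d),
          AffineProc.IsLevyMeasure ν ∧ AffineProc.IsAffineCombination ν m μ x) ∧
    ∀ u ∈ AffineProc.U D,
      φ 0 u = 0 ∧ ψ 0 u = u ∧
      ∀ t : ℝ, 0 ≤ t → ENNReal.ofReal t < AffineProc.sigma Φ u →
        ψ t u ∈ AffineProc.U D ∧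
        HasDerivWithinAt (fun s => φ s u) (F (ψ t u)) (Ici 0) t ∧
        HasDerivWithinAt (fun s => ψ s u) (R (ψ t u)) (Ici 0) t := by
  open AffineProc in
  refine ⟨?_, fun u hu => ?_⟩
  · have hex := fun x : D => exists_levyKhintchine_exponent hD_ne hD_span haff hdist hreg x
    obtain ⟨⟨a, b, c, m, ha, hF⟩, hR⟩ := mem_lkSubmodule (F := F) (R := R) (S := U D) hD_ne hD_span
      fun x hx => by
        obtain ⟨a, b, c, κ, hκ, ha, h⟩ := hex ⟨x, hx⟩
        exact ⟨a, b, c, _, ha, h⟩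
    choose α β γ μ hα hR using hR
    refine ⟨a, α, b, β, c, γ, m, μ, hF, hR, fun x hx => ?_⟩
    obtain ⟨b', m', hx1, hx2⟩ := hF.add_sum hR x Finset.univ
    have hre := fun y => re_exponent_nonpos hD_ne hD_span haff hdist hreg ⟨x, hx⟩ y
    refine ⟨hx1.posSemidef imag_mem_U ?_ hre, ?_, ?_⟩
    · rw [Matrix.IsSymm, Matrix.transpose_add, Matrix.transpose_sum, ha]
      simp only [Matrix.transpose_smul, (hα _).eq]
    · have h0 := hx1.at_zero (by simpa using imag_mem_U (D := D) 0)
      have h1 := hre 0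
      rw [imag_zero, pairing_eq_sum, h0] at h1
      simp at h1
      linarith
    · obtain ⟨a₁, b₁, c₁, κ, hκ, ha₁, h⟩ := hex ⟨x, hx⟩
      refine ⟨κ, hκ, fun A _ hA => ?_⟩
      obtain ⟨ε, hε, hA'⟩ := hA
      rw [← hx2 A ⟨ε, hε, hA'⟩,
        ← SignedLevyMeasure.value_eq_of_add_eq (h.pos_add_neg_eq hx1 imag_mem_U) hε hA']
      simp [SignedLevyMeasure.value, SignedLevyMeasure.ofMeasure]
  · obtain ⟨h1, h2⟩ := initial_values hD_ne hD_span haff hdist hu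
    exact ⟨h1, h2, fun t ht0 ht => ⟨psi_mem_U haff hdist hu ht0 ht,
      riccati hD_ne hD_span haff hdist hreg hu ht0 ht⟩⟩
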